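/- **Setting.** Let $\mathcal D_d$ be the set of quantum states, i.e. Hermitian positive semidefinite matrices in $\mathbb C^{d\times d}$ with unit trace. For a Hermitian matrix with eigendecomposition $Q=\sum_i\lambda_iP_i$ write $Q^r=\sum_i\lambda_i^rP_i$. For $A\in\mathcal D_d$ and positive semidefinite $Q$, the Petz–Rényi divergence of order $\alpha\in(0,1)\cup(1,\infty)$ is $$D_\alpha(A\Vert Q)=\frac1{\alpha-1}\log\operatorname{Tr}\left[A^\alpha Q^{1-\alpha}\right],$$ with $D_\alpha(A\Vert Q)=+\infty$ if the trace vanishes, or if $\alpha>1$ and the support of $A$ is not contained in the support of $Q$ (for $\alpha>1$ and singular $Q$, the power $Q^{1-\alpha}$ is taken on the support of $Q$). Let $A_1,\dots,A_n\in\mathcal D_d$ be such that $\sum_{j=1}^nA_j$ has full rank, and let $w_j>0$ with $\sum_{j=1}^nw_j=1$. Put $F(Q)=\sum_{j=1}^nw_jD_\alpha(A_j\Vert Q)$, and for positive definite $U$ put $$T_F(U)=\left(\sum_{j=1}^nw_j\frac{A_j^\alpha}{\operatorname{Tr}[A_j^\alpha U]}\right)^{(1-\alpha)/\alpha}.$$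 For positive definite $U,V$, the Thompson metric is $d_{\mathrm T}(V,U)=\inf\{r\ge0: e^{-r}V\le U\le e^rV\}$, where $\le$ is the Loewner order (and $\inf\emptyset=+\infty$). **Theorem.** Let $\alpha\in(1/2,1)\cup(1,\infty)$. Let $Q_1\in\operatorname{relint}(\mathcal D_d)$ and, for $t=1,2,\dots$, let $$Q_{t+1}=T_F\left(Q_t^{1-\alpha}\right)^{1/(1-\alpha)}.$$ Then all $Q_t$ are positive definite and $Q_{t+1}=\left(\sum_{j=1}^nw_jA_j^\alpha/\operatorname{Tr}[A_j^\alpha Q_t^{1-\alpha}]\right)^{1/\alpha}$. The function $F$ has a unique minimizer $Q_\star$ over $\mathcal D_d$; it is positive definite and $F(Q_\star)$ is finite. For every integer $T\ge0$, $$F\left(\frac{Q_{T+1}}{\operatorname{Tr}[Q_{T+1}]}\right)-F(Q_\star)\le\left|\frac1{\alpha-1}\right|d_{\mathrm T}\left(Q_\star^{1-\alpha},\left(\frac{Q_{T+1}}{\operatorname{Tr}[Q_{T+1}]}\right)^{1-\alpha}\right)\le\left|\frac2{\alpha-1}\right|\cdot\left|1-\frac1\alpha\right|^T d_{\mathrm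 T}\left(Q_\star^{1-\alpha},Q_1^{1-\alpha}\right),$$ and $d_{\mathrm T}(Q_\star^{1-\alpha},Q_1^{1-\alpha})<\infty$. Moreover, if $\alpha>1$, then for every $t\ge1$ $$F\left(\frac{Q_{t+1}}{\operatorname{Tr}[Q_{t+1}]}\right)\le F\left(\frac{Q_t}{\operatorname{Tr}[Q_t]}\right).$$ -/

import Mathlib

open scoped ComplexOrder

noncomputable section

/-- The real power `A ^ r` of a Hermitian matrix, `∑ i, λ i ^ r • P i` for the eigendecomposition
`A = ∑ i, λ i • P i`. -/
def matrixPow {d : ℕ} (A : Matrix (Fin d) (Fin d) ℂ) (r : ℝ) : Matrix (Fin d) (Fin d) ℂ :=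
  cfc (fun x : ℝ => x ^ r) A

/-- The set of quantum states: Hermitian positive semidefinite matrices with unit trace. -/
def quantumStates (d : ℕ) : Set (Matrix (Fin d) (Fin d) ℂ) :=
  {Q | Q.PosSemidef ∧ Q.trace = 1}

/-- The quantity `Tr[A ^ α * U]`, which is real for positive semidefinite `A` and Hermitian `U`. -/
def powTrace {d : ℕ} (α : ℝ) (A U : Matrix (Fin d) (Fin d) ℂ) : ℝ :=
  (matrixPow A α * U).trace.re

open Classical in
/-- The Petz-Rényi divergence `D_α(A ‖ Q) = (α - 1)⁻¹ log Tr[A ^ α * Q ^ (1 - α)]`. It is `⊤` where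
the right-hand side is not defined: if the trace vanishes, or if `1 < α` and the
support of `A` is not contained in that of `Q` (that is, `ker Q` is not contained in `ker A`). -/
def petzRenyiDiv {d : ℕ} (α : ℝ) (A Q : Matrix (Fin d) (Fin d) ℂ) : EReal :=
  if (1 < α → ∀ v : Fin d → ℂ, Q.mulVec v = 0 → A.mulVec v = 0) ∧
      0 < powTrace α A (matrixPow Q (1 - α)) then
    ((1 / (α - 1) * Real.log (powTrace α A (matrixPow Q (1 - α))) : ℝ) : EReal)
  else ⊤

/-- The objective function `F(Q) = ∑ j, w j * D_α(A j ‖ Q)`. -/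
def augustinObjective {d n : ℕ} (α : ℝ) (w : Fin n → ℝ) (A : Fin n → Matrix (Fin d) (Fin d) ℂ)
    (Q : Matrix (Fin d) (Fin d) ℂ) : EReal :=
  ∑ j, (w j : EReal) * petzRenyiDiv α (A j) Q

/-- `Q` is a minimizer of the objective function over the quantum states. -/
def IsPetzAugustinMean {d n : ℕ} (α : ℝ) (w : Fin n → ℝ)
    (A : Fin n → Matrix (Fin d) (Fin d) ℂ) (Q : Matrix (Fin d) (Fin d) ℂ) : Prop :=
  Q ∈ quantumStates d ∧ IsMinOn (augustinObjective α w A) (quantumStates d) Q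

/-- The operator `T_F(U) = (∑ j, w j / Tr[A j ^ α * U] • A j ^ α) ^ ((1 - α) / α)`. -/
def augustinOperator {d n : ℕ} (α : ℝ) (w : Fin n → ℝ) (A : Fin n → Matrix (Fin d) (Fin d) ℂ)
    (U : Matrix (Fin d) (Fin d) ℂ) : Matrix (Fin d) (Fin d) ℂ :=
  matrixPow (∑ j, (w j / powTrace α (A j) U) • matrixPow (A j) α) ((1 - α) / α)

/-- Trace normalization `Q / Tr[Q]`. -/
def traceNormalize {d : ℕ} (Q : Matrix (Fin d) (Fin d) ℂ) : Matrix (Fin d) (Fin d) ℂ :=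
  (Q.trace)⁻¹ • Q

/-- The Thompson metric `inf {r ≥ 0 | exp (-r) V ≤ U ≤ exp r V}` with respect to the Loewner
order; it is `⊤` if there is no such `r`. -/
def thompsonDist {d : ℕ} (V U : Matrix (Fin d) (Fin d) ℂ) : EReal :=
  sInf ((fun r : ℝ => (r : EReal)) '' {r : ℝ | 0 ≤ r ∧
    (U - Real.exp (-r) • V).PosSemidef ∧ (Real.exp r • V - U).PosSemidef})

end

open scoped ComplexOrder

section Augustin

open scoped MatrixOrder Matrix.Norms.L2Operator

variable {d n : ℕ}

/-! ### Real powers of positive matrices -/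

/-! Write `B j` for `A j ^ α` and pass to the variable `U = Q ^ (1 - α)`. One step of the iteration
is then the map `U ↦ ∑ j, w j / Tr[B j U] • B j` followed by the power `(1 - α) / α`. The first map
is nonexpansive for the Thompson metric, since each coefficient changes by at most the factor by
which `U` does. A power `s` with `|s| ≤ 1` contracts the metric by `|s|`, by operator monotonicity
(Löwner–Heinz) and homogeneity. As `α > 1/2`, the step contracts by `|1 - 1/α| < 1` and has a fixed
point `P` (`exists_fixedPoint_of_contraction`), with `P ^ α = ∑ j, w j / Tr[B j P ^ (1 - α)] • B j`.
Pairing this with `P ^ (1 - α)` gives `Tr P = 1`.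

The fixed point is the unique minimizer. For `α < 1`, Jensen's inequality for the logarithm bounds
`∑ j, w j log (Tr[B j Q ^ (1 - α)] / Tr[B j P ^ (1 - α)])` by `log Tr[P ^ α Q ^ (1 - α)]`, which is
at most `0` by the trace Young inequality. For `α > 1`, Jensen and the reverse Hölder inequality
show that each step decreases the normalized objective; iterating from an arbitrary competitor
converges to `P`, so the competitor is no better. Equality cases come from those of the Young
inequalities.

The rates follow because the objective is Lipschitz in the Thompson metric with constant `|1 / (α -
1)|`, and because normalizing the trace at most doubles the distance to the unit-trace matrix `P`
(`LoewnerClose.trace_normalize`). -/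

theorem continuousOn_real_spectrum (A : Matrix (Fin d) (Fin d) ℂ) (f : ℝ → ℝ) :
    ContinuousOn f (spectrum ℝ A) :=
  A.finite_real_spectrum.continuousOn f

theorem Matrix.PosSemidef.spectrum_nonneg {A : Matrix (Fin d) (Fin d) ℂ} (hA : A.PosSemidef) {x : ℝ}
    (hx : x ∈ spectrum ℝ A) : 0 ≤ x := by
  rw [hA.1.spectrum_real_eq_range_eigenvalues] at hx
  obtain ⟨i, rfl⟩ := hx
  exact hA.eigenvalues_nonneg i

theorem Matrix.PosDef.spectrum_pos {A : Matrix (Fin d) (Fin d) ℂ} (hA : A.PosDef) {x : ℝ}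
    (hx : x ∈ spectrum ℝ A) : 0 < x := by
  rw [hA.1.spectrum_real_eq_range_eigenvalues] at hx
  obtain ⟨i, rfl⟩ := hx
  exact hA.eigenvalues_pos i

theorem Matrix.PosDef.of_le {A B : Matrix (Fin d) (Fin d) ℂ} (hA : A.PosDef) (hAB : A ≤ B) :
    B.PosDef := by
  have := hA.add_posSemidef (Matrix.le_iff.1 hAB)
  rwa [add_sub_cancel] at this

theorem matrixPow_posSemidef {A : Matrix (Fin d) (Fin d) ℂ} (hA : A.PosSemidef) (r : ℝ) :
    (matrixPow A r).PosSemidef := by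
  rw [← Matrix.nonneg_iff_posSemidef]
  exact cfc_nonneg fun x hx => Real.rpow_nonneg (hA.spectrum_nonneg hx) r

theorem matrixPow_mul_matrixPow {A : Matrix (Fin d) (Fin d) ℂ} (hA : A.PosDef) (r s : ℝ) :
    matrixPow A r * matrixPow A s = matrixPow A (r + s) := by
  unfold matrixPow
  rw [← cfc_mul _ _ A (continuousOn_real_spectrum _ _) (continuousOn_real_spectrum _ _)]
  exact cfc_congr fun x hx => (Real.rpow_add (hA.spectrum_pos hx) r s).symm

theorem matrixPow_one {A : Matrix (Fin d) (Fin d) ℂ} (hA : A.IsHermitian) : matrixPow A 1 = A := by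
  unfold matrixPow
  simp only [Real.rpow_one]
  exact cfc_id' ℝ A hA.isSelfAdjoint

theorem matrixPow_zero {A : Matrix (Fin d) (Fin d) ℂ} (hA : A.IsHermitian) : matrixPow A 0 = 1 := by
  unfold matrixPow
  simp only [Real.rpow_zero]
  exact cfc_const_one ℝ A hA.isSelfAdjoint

theorem matrixPow_posDef {A : Matrix (Fin d) (Fin d) ℂ} (hA : A.PosDef) (r : ℝ) :
    (matrixPow A r).PosDef := by
  rw [(matrixPow_posSemidef hA.posSemidef r).posDef_iff_isUnit]
  have h := matrixPow_mul_matrixPow hA r (-r)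
  rw [add_neg_cancel, matrixPow_zero hA.1] at h
  exact IsUnit.of_mul_eq_one _ h

theorem matrixPow_matrixPow {A : Matrix (Fin d) (Fin d) ℂ} (hA : A.PosDef) (r s : ℝ) :
    matrixPow (matrixPow A r) s = matrixPow A (r * s) := by
  unfold matrixPow
  rw [← cfc_comp' (fun x : ℝ => x ^ s) (fun x : ℝ => x ^ r) A
    ((A.finite_real_spectrum.image _).continuousOn _) (continuousOn_real_spectrum _ _)
    hA.1.isSelfAdjoint]
  exact cfc_congr fun x hx => (Real.rpow_mul (hA.spectrum_pos hx).le r s).symm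

theorem matrixPow_smul {A : Matrix (Fin d) (Fin d) ℂ} (hA : A.PosSemidef) {c : ℝ} (hc : 0 ≤ c)
    (r : ℝ) : matrixPow (c • A) r = c ^ r • matrixPow A r := by
  unfold matrixPow
  rw [← cfc_comp_smul c (fun x : ℝ => x ^ r) A
    ((A.finite_real_spectrum.image _).continuousOn _) hA.1.isSelfAdjoint,
    ← cfc_smul (c ^ r) _ A (continuousOn_real_spectrum _ _)]
  exact cfc_congr fun x hx => by
    simp [Real.mul_rpow hc (hA.spectrum_nonneg hx)]

/-- Zero eigenvalues cause no harm because `0 ^ r = 0` for `r > 0`, whatever the value of `0 ^ (1 -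
r)`. This lets kernels be compared for singular matrices. -/
theorem matrixPow_mul_matrixPow_self {A : Matrix (Fin d) (Fin d) ℂ} (hA : A.PosSemidef) {r : ℝ}
    (hr : 0 < r) : matrixPow A (1 - r) * matrixPow A r = A := by
  conv_rhs => rw [← cfc_id' ℝ A hA.1.isSelfAdjoint]
  unfold matrixPow
  rw [← cfc_mul _ _ A (continuousOn_real_spectrum _ _) (continuousOn_real_spectrum _ _)]
  refine cfc_congr fun x hx => ?_
  rcases (hA.spectrum_nonneg hx).eq_or_lt with h | h
  · simp [← h, Real.zero_rpow hr.ne']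
  · simp [← Real.rpow_add h]

theorem matrixPow_eq_rpow {A : Matrix (Fin d) (Fin d) ℂ} (hA : A.PosSemidef) (r : ℝ) :
    matrixPow A r = A ^ r :=
  (CFC.rpow_eq_cfc_real (Matrix.nonneg_iff_posSemidef.2 hA)).symm

theorem matrixPow_le_matrixPow {A B : Matrix (Fin d) (Fin d) ℂ} (hA : A.PosSemidef)
    (hAB : A ≤ B) {r : ℝ} (hr : r ∈ Set.Icc (0 : ℝ) 1) : matrixPow A r ≤ matrixPow B r := by
  have hB : B.PosSemidef := Matrix.nonneg_iff_posSemidef.1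
    ((Matrix.nonneg_iff_posSemidef.2 hA).trans hAB)
  rw [matrixPow_eq_rpow hA, matrixPow_eq_rpow hB]
  exact CFC.rpow_le_rpow hr hAB

/-- Löwner–Heinz for the exponent `-r`, followed by order reversal under inversion. -/
theorem matrixPow_le_matrixPow_of_nonpos {A B : Matrix (Fin d) (Fin d) ℂ} (hA : A.PosDef)
    (hAB : A ≤ B) {r : ℝ} (hr : r ∈ Set.Icc (-1 : ℝ) 0) : matrixPow B r ≤ matrixPow A r := by
  have hB := hA.of_le hAB
  have h := matrixPow_le_matrixPow hA.posSemidef hAB (r := -r)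
    ⟨by linarith [hr.2], by linarith [hr.1]⟩
  have h' := CStarAlgebra.rpow_neg_one_le_rpow_neg_one h
    (Matrix.isStrictlyPositive_iff_posDef.2 (matrixPow_posDef hA _))
  rwa [← matrixPow_eq_rpow (matrixPow_posSemidef hA.posSemidef _),
    ← matrixPow_eq_rpow (matrixPow_posSemidef hB.posSemidef _), matrixPow_matrixPow hA,
    matrixPow_matrixPow hB, mul_neg_one, neg_neg] at h'

/-! ### Trace inequalities -/

open Matrix in
/-- The trace of a product of functions of two Hermitian matrices is a nonnegative combination of
the products of the function values at the eigenvalues. -/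
theorem exists_trace_cfc_mul_cfc {P Q : Matrix (Fin d) (Fin d) ℂ} (hP : P.IsHermitian)
    (hQ : Q.IsHermitian) :
    ∃ W : Fin d → Fin d → ℝ, (∀ i j, 0 ≤ W i j) ∧ ∀ f g : ℝ → ℝ,
      (cfc f P * cfc g Q).trace.re =
        ∑ i, ∑ j, f (hP.eigenvalues i) * g (hQ.eigenvalues j) * W i j := by
  set U := (hP.eigenvectorUnitary : Matrix (Fin d) (Fin d) ℂ) with hU
  set V := (hQ.eigenvectorUnitary : Matrix (Fin d) (Fin d) ℂ) with hV
  refine ⟨fun i j => Complex.normSq ((star U * V) i j), fun i j => Complex.normSq_nonneg _,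
    fun f g => ?_⟩
  have h : (cfc f P * cfc g Q).trace =
      (diagonal (RCLike.ofReal ∘ f ∘ hP.eigenvalues) * (star U * V) *
        diagonal (RCLike.ofReal ∘ g ∘ hQ.eigenvalues) * star (star U * V)).trace := by
    rw [hP.cfc_eq, hQ.cfc_eq, IsHermitian.cfc, IsHermitian.cfc, Unitary.conjStarAlgAut_apply,
      Unitary.conjStarAlgAut_apply, ← hU, ← hV, star_mul, star_star]
    simp only [Matrix.mul_assoc]
    rw [Matrix.trace_mul_comm]
    simp only [Matrix.mul_assoc]
  rw [h, Matrix.trace, Complex.re_sum]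
  refine Finset.sum_congr rfl fun i _ => ?_
  rw [Matrix.diag_apply, Matrix.mul_apply, Complex.re_sum]
  refine Finset.sum_congr rfl fun j _ => ?_
  rw [mul_diagonal, diagonal_mul, star_apply]
  simp only [Function.comp_apply, Complex.normSq_apply, Complex.mul_re, Complex.mul_im,
    Complex.star_def, Complex.conj_re, Complex.conj_im, Complex.coe_algebraMap,
    Complex.ofReal_re, Complex.ofReal_im]
  simp
  ring

/-- Summing a pointwise inequality between values at the eigenvalues of two Hermitian matrices. -/
theorem sum_trace_cfc_mul_cfc_nonneg {ι : Type*} (s : Finset ι) {P Q : Matrix (Fin d) (Fin d) ℂ}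
    (hP : P.IsHermitian) (hQ : Q.IsHermitian) (f g : ι → ℝ → ℝ)
    (h : ∀ x ∈ spectrum ℝ P, ∀ y ∈ spectrum ℝ Q, 0 ≤ ∑ k ∈ s, f k x * g k y) :
    0 ≤ ∑ k ∈ s, (cfc (f k) P * cfc (g k) Q).trace.re := by
  obtain ⟨W, hW, hfg⟩ := exists_trace_cfc_mul_cfc hP hQ
  simp only [hfg]
  rw [Finset.sum_comm]
  refine Finset.sum_nonneg fun i _ => ?_
  rw [Finset.sum_comm]
  refine Finset.sum_nonneg fun j _ => ?_
  rw [← Finset.sum_mul]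
  exact mul_nonneg (h _ (hP.eigenvalues_mem_spectrum_real i) _ (hQ.eigenvalues_mem_spectrum_real j))
    (hW i j)

theorem trace_mul_re_nonneg {X Y : Matrix (Fin d) (Fin d) ℂ} (hX : X.PosSemidef)
    (hY : Y.PosSemidef) : 0 ≤ (X * Y).trace.re := by
  obtain ⟨W, hW, hfg⟩ := exists_trace_cfc_mul_cfc hX.1 hY.1
  have h := hfg (fun x => x) (fun x => x)
  rw [cfc_id' ℝ X hX.1.isSelfAdjoint, cfc_id' ℝ Y hY.1.isSelfAdjoint] at h
  rw [h]
  exact Finset.sum_nonneg fun i _ => Finset.sum_nonneg fun j _ =>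
    mul_nonneg (mul_nonneg (hX.eigenvalues_nonneg i) (hY.eigenvalues_nonneg j)) (hW i j)

theorem Matrix.PosSemidef.ofReal_re_trace {X : Matrix (Fin d) (Fin d) ℂ} (hX : X.PosSemidef) :
    (X.trace.re : ℂ) = X.trace :=
  Complex.ext rfl (Complex.nonneg_iff.1 hX.trace_nonneg).2

theorem trace_mul_re_pos {X Y : Matrix (Fin d) (Fin d) ℂ} (hX : X.PosSemidef) (hX0 : X ≠ 0)
    (hY : Y.PosDef) : 0 < (X * Y).trace.re := by
  refine (trace_mul_re_nonneg hX hY.posSemidef).lt_of_ne fun h0 => hX0 ?_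
  obtain ⟨W, hW, hfg⟩ := exists_trace_cfc_mul_cfc hX.1 hY.1
  have h := hfg (fun x => x) (fun x => x)
  have h1 := hfg (fun x => x) (fun _ => 1)
  rw [cfc_id' ℝ X hX.1.isSelfAdjoint, cfc_id' ℝ Y hY.1.isSelfAdjoint, ← h0] at h
  -- The same weights `W` also compute `Tr X`, by taking the second function constant; cancelling
  -- the positive eigenvalues of `Y` makes every term vanish.
  rw [cfc_id' ℝ X hX.1.isSelfAdjoint, cfc_const_one ℝ Y hY.1.isSelfAdjoint, mul_one] at h1
  have hnn : ∀ i j, 0 ≤ hX.1.eigenvalues i * hY.1.eigenvalues j * W i j := fun i j =>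
    mul_nonneg (mul_nonneg (hX.eigenvalues_nonneg i) (hY.eigenvalues_pos j).le) (hW i j)
  have hz : ∀ i j, hX.1.eigenvalues i * 1 * W i j = 0 := by
    intro i j
    have hi := (Finset.sum_eq_zero_iff_of_nonneg fun i _ =>
      Finset.sum_nonneg fun j _ => hnn i j).1 h.symm i (Finset.mem_univ i)
    have hj := (Finset.sum_eq_zero_iff_of_nonneg fun j _ => hnn i j).1 hi j (Finset.mem_univ j)
    have := (hY.eigenvalues_pos j).ne'
    grind
  simp only [hz, Finset.sum_const_zero] at h1
  rw [← hX.trace_eq_zero_iff, ← hX.ofReal_re_trace, h1, Complex.ofReal_zero]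

/-- Klein's inequality. -/
theorem klein_inequality {X Y : Matrix (Fin d) (Fin d) ℂ} (hX : X.IsHermitian) (hY : Y.IsHermitian)
    (f f' : ℝ → ℝ)
    (hf : ∀ x ∈ spectrum ℝ X, ∀ y ∈ spectrum ℝ Y, f y + f' y * (x - y) ≤ f x) :
    (cfc f Y).trace.re + (cfc f' Y * (X - Y)).trace.re ≤ (cfc f X).trace.re := by
  -- The four products add up to `f x - f y - f' y * (x - y)`.
  have h := sum_trace_cfc_mul_cfc_nonneg (Finset.univ : Finset (Fin 4)) hX hY
    ![f, fun _ => -1, fun x => -x, fun _ => 1] ![fun _ => 1, f, f', fun y => f' y * y]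
    (fun x hx y hy => by
      have := hf x hx y hy
      simp [Fin.sum_univ_four]
      linarith)
  have e1 : cfc (fun y => f' y * y) Y = cfc f' Y * Y := by
    rw [cfc_mul _ _ Y (continuousOn_real_spectrum _ _) (continuousOn_real_spectrum _ _),
      cfc_id' ℝ Y hY.isSelfAdjoint]
  have e2 : cfc (fun _ : ℝ => (-1 : ℝ)) X = -1 := by
    rw [cfc_neg (fun _ : ℝ => (1 : ℝ)), cfc_const_one ℝ X hX.isSelfAdjoint]
  have e3 : cfc (fun x : ℝ => -x) X = -X := by
    rw [cfc_neg (fun x : ℝ => x), cfc_id' ℝ X hX.isSelfAdjoint]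
  simp only [Fin.sum_univ_four, Matrix.cons_val] at h
  rw [e1, e2, e3, cfc_const_one ℝ X hX.isSelfAdjoint, cfc_const_one ℝ Y hY.isSelfAdjoint] at h
  rw [mul_sub, Matrix.trace_sub, Matrix.trace_mul_comm _ X]
  simp at h ⊢
  linarith

/-- If the sum vanishes, the weight `W i j` can be nonzero only where the eigenvalues agree. Hence
`∑ (p i - q j) ^ 2 * W i j = Tr (P - Q) ^ 2` is zero. -/
theorem eq_of_sum_trace_cfc_mul_cfc_eq_zero {ι : Type*} (s : Finset ι)
    {P Q : Matrix (Fin d) (Fin d) ℂ} (hP : P.IsHermitian) (hQ : Q.IsHermitian) (f g : ι → ℝ → ℝ)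
    (h : ∀ x ∈ spectrum ℝ P, ∀ y ∈ spectrum ℝ Q, x ≠ y → 0 < ∑ k ∈ s, f k x * g k y)
    (h' : ∀ x ∈ spectrum ℝ P, ∀ y ∈ spectrum ℝ Q, 0 ≤ ∑ k ∈ s, f k x * g k y)
    (h0 : ∑ k ∈ s, (cfc (f k) P * cfc (g k) Q).trace.re = 0) : P = Q := by
  obtain ⟨W, hW, hfg⟩ := exists_trace_cfc_mul_cfc hP hQ
  set p := hP.eigenvalues
  set q := hQ.eigenvalues
  have hp := hP.eigenvalues_mem_spectrum_real
  have hq := hQ.eigenvalues_mem_spectrum_real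
  have h1 : ∑ i, ∑ j, (∑ k ∈ s, f k (p i) * g k (q j)) * W i j = 0 := by
    rw [← h0]
    simp only [hfg, Finset.sum_mul]
    rw [Finset.sum_comm' (s := s) (t' := Finset.univ) (s' := fun _ => s) (by simp)]
    refine Finset.sum_congr rfl fun i _ => ?_
    rw [Finset.sum_comm]
  have hnn : ∀ i j, 0 ≤ (∑ k ∈ s, f k (p i) * g k (q j)) * W i j := fun i j =>
    mul_nonneg (h' _ (hp i) _ (hq j)) (hW i j)
  have hz : ∀ i j, (p i - q j) * W i j = 0 := by
    intro i j
    have hi := (Finset.sum_eq_zero_iff_of_nonneg fun i _ =>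
      Finset.sum_nonneg fun j _ => hnn i j).1 h1 i (Finset.mem_univ i)
    have hj := (Finset.sum_eq_zero_iff_of_nonneg fun j _ => hnn i j).1 hi j (Finset.mem_univ j)
    by_cases hij : p i = q j
    · simp [hij]
    · rw [(mul_eq_zero.1 hj).resolve_left (h _ (hp i) _ (hq j) hij).ne', mul_zero]
  have hPP : cfc (fun x : ℝ => x * x) P = P * P := by
    rw [cfc_mul _ _ P (continuousOn_real_spectrum _ _) (continuousOn_real_spectrum _ _),
      cfc_id' ℝ P hP.isSelfAdjoint]
  have hQQ : cfc (fun x : ℝ => x * x) Q = Q * Q := by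
    rw [cfc_mul _ _ Q (continuousOn_real_spectrum _ _) (continuousOn_real_spectrum _ _),
      cfc_id' ℝ Q hQ.isSelfAdjoint]
  have t1 := hfg (fun x => x * x) (fun _ => 1)
  have t2 := hfg (fun x => x) (fun x => x)
  have t3 := hfg (fun _ => 1) (fun x => x * x)
  rw [hPP, cfc_const_one ℝ Q hQ.isSelfAdjoint, mul_one] at t1
  rw [cfc_id' ℝ P hP.isSelfAdjoint, cfc_id' ℝ Q hQ.isSelfAdjoint] at t2
  rw [hQQ, cfc_const_one ℝ P hP.isSelfAdjoint, one_mul] at t3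
  have ht : ((P - Q) * (P - Q)).trace.re = 0 := by
    rw [sub_mul, mul_sub, mul_sub, Matrix.trace_sub, Matrix.trace_sub, Matrix.trace_sub,
      Matrix.trace_mul_comm Q P]
    simp only [Complex.sub_re]
    rw [t1, t2, t3]
    simp only [← Finset.sum_sub_distrib]
    refine Finset.sum_eq_zero fun i _ => Finset.sum_eq_zero fun j _ => ?_
    linear_combination (p i - q j) * hz i j
  have hPQ : (P - Q).IsHermitian := hP.sub hQ
  have hsq : ((P - Q).conjTranspose * (P - Q)).PosSemidef :=
    Matrix.posSemidef_conjTranspose_mul_self _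
  have : ((P - Q).conjTranspose * (P - Q)).trace = 0 := by
    rw [← hsq.ofReal_re_trace, hPQ.eq, ht, Complex.ofReal_zero]
  exact sub_eq_zero.1 (Matrix.trace_conjTranspose_mul_self_eq_zero_iff.1 this)

/-- Bernoulli's inequality at `q / p`, multiplied by `p`. Allowing `q = 0` matters, since for `α <
1` the competitor may be singular. -/
theorem rpow_mul_rpow_lt_of_lt_one {p q α : ℝ} (hp : 0 < p) (hq : 0 ≤ q) (hpq : p ≠ q)
    (hα : 0 < α) (hα1 : α < 1) : p ^ α * q ^ (1 - α) < α * p + (1 - α) * q := by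
  have h := rpow_one_add_lt_one_add_mul_self (s := q / p - 1) (by linarith [div_nonneg hq hp.le])
    (by rw [sub_ne_zero, ne_eq, div_eq_one_iff_eq hp.ne']; exact hpq.symm)
    (p := 1 - α) (by linarith) (by linarith)
  rw [add_sub_cancel, Real.div_rpow hq hp.le] at h
  have hpp : p = p ^ α * p ^ (1 - α) := by rw [← Real.rpow_add hp, add_sub_cancel, Real.rpow_one]
  have h' := mul_lt_mul_of_pos_left h hp
  have e : p * (q ^ (1 - α) / p ^ (1 - α)) = p ^ α * q ^ (1 - α) := by
    have : p ^ (1 - α) ≠ 0 := (Real.rpow_pos_of_pos hp _).ne'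
    rw [mul_div_assoc', div_eq_iff this]
    linear_combination q ^ (1 - α) * hpp
  rw [e] at h'
  refine h'.trans_eq ?_
  field_simp
  ring

theorem lt_rpow_mul_rpow_of_one_lt {p q α : ℝ} (hp : 0 ≤ p) (hq : 0 < q) (hpq : p ≠ q)
    (hα : 1 < α) : α * p + (1 - α) * q < p ^ α * q ^ (1 - α) := by
  have h := one_add_mul_self_lt_rpow_one_add (s := p / q - 1) (by linarith [div_nonneg hp hq.le])
    (by rw [sub_ne_zero, ne_eq, div_eq_one_iff_eq hq.ne']; exact hpq) (p := α) hα
  rw [add_sub_cancel, Real.div_rpow hp hq.le] at h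
  have h' := mul_lt_mul_of_pos_left h hq
  have e : q * (p ^ α / q ^ α) = p ^ α * q ^ (1 - α) := by
    rw [Real.rpow_sub hq, Real.rpow_one]
    ring
  rw [e] at h'
  refine h'.trans_eq' ?_
  field_simp
  ring

/-- Trace form of Young's inequality, with its equality case; the sign `c` distinguishes the
direct inequality from the reverse one. -/
theorem trace_young {P Q : Matrix (Fin d) (Fin d) ℂ} (hP : P.PosDef) (hQ : Q.IsHermitian)
    {α c : ℝ} (h : ∀ x ∈ spectrum ℝ P, ∀ y ∈ spectrum ℝ Q, x ≠ y →
      0 < c * (α * x + (1 - α) * y - x ^ α * y ^ (1 - α))) :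
    0 ≤ c * (α * P.trace.re + (1 - α) * Q.trace.re -
        (matrixPow P α * matrixPow Q (1 - α)).trace.re) ∧
    (c * (α * P.trace.re + (1 - α) * Q.trace.re -
        (matrixPow P α * matrixPow Q (1 - α)).trace.re) = 0 → P = Q) := by
  -- These products sum to `c * (α * x + (1 - α) * y - x ^ α * y ^ (1 - α))`.
  let f : Fin 3 → ℝ → ℝ := ![fun x => c * (α * x), fun _ => c * (1 - α), fun x => -c * x ^ α]
  let g : Fin 3 → ℝ → ℝ := ![fun _ => 1, fun y => y, fun y => y ^ (1 - α)]
  have hsum : ∑ k, (cfc (f k) P * cfc (g k) Q).trace.re =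
      c * (α * P.trace.re + (1 - α) * Q.trace.re -
        (matrixPow P α * matrixPow Q (1 - α)).trace.re) := by
    have e1 : cfc (fun x : ℝ => c * (α * x)) P = (c * α) • P := by
      rw [← cfc_const_mul_id (c * α) P hP.1.isSelfAdjoint]
      simp only [mul_assoc]
    have e2 : cfc (fun _ : ℝ => c * (1 - α)) P = (c * (1 - α)) • 1 := by
      rw [cfc_const _ P hP.1.isSelfAdjoint, Algebra.algebraMap_eq_smul_one]
    have e3 : cfc (fun x : ℝ => -c * x ^ α) P = (-c) • matrixPow P α :=
      cfc_const_mul _ _ P (continuousOn_real_spectrum _ _)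
    simp only [f, g, Fin.sum_univ_three, Matrix.cons_val]
    rw [e1, e2, e3, cfc_const_one ℝ Q hQ.isSelfAdjoint, cfc_id' ℝ Q hQ.isSelfAdjoint,
      ← matrixPow.eq_def]
    simp
    ring
  have hpt : ∀ x y : ℝ, ∑ k, f k x * g k y =
      c * (α * x + (1 - α) * y - x ^ α * y ^ (1 - α)) := fun x y => by
    simp only [f, g, Fin.sum_univ_three, Matrix.cons_val]
    ring
  have hlt : ∀ x ∈ spectrum ℝ P, ∀ y ∈ spectrum ℝ Q, x ≠ y → 0 < ∑ k, f k x * g k y :=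
    fun x hx y hy hxy => by rw [hpt]; exact h x hx y hy hxy
  have hle : ∀ x ∈ spectrum ℝ P, ∀ y ∈ spectrum ℝ Q, 0 ≤ ∑ k, f k x * g k y := by
    intro x hx y hy
    by_cases hxy : x = y
    · subst hxy
      rw [hpt, ← Real.rpow_add (hP.spectrum_pos hx), add_sub_cancel, Real.rpow_one]
      exact le_of_eq (by ring)
    · exact (hlt x hx y hy hxy).le
  rw [← hsum]
  exact ⟨sum_trace_cfc_mul_cfc_nonneg Finset.univ hP.1 hQ f g hle,
    eq_of_sum_trace_cfc_mul_cfc_eq_zero Finset.univ hP.1 hQ f g hlt hle⟩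

theorem trace_young_of_lt_one {P Q : Matrix (Fin d) (Fin d) ℂ} (hP : P.PosDef)
    (hQ : Q.PosSemidef) {α : ℝ} (hα : 0 < α) (hα1 : α < 1) :
    (matrixPow P α * matrixPow Q (1 - α)).trace.re ≤ α * P.trace.re + (1 - α) * Q.trace.re ∧
    ((matrixPow P α * matrixPow Q (1 - α)).trace.re = α * P.trace.re + (1 - α) * Q.trace.re →
      P = Q) := by
  obtain ⟨h1, h2⟩ := trace_young (c := 1) (α := α) hP hQ.1 fun x hx y hy hxy => by
    linarith [rpow_mul_rpow_lt_of_lt_one (hP.spectrum_pos hx) (hQ.spectrum_nonneg hy) hxy hα hα1]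
  exact ⟨by linarith, fun h => h2 (by linarith)⟩

theorem trace_young_of_one_lt {P Q : Matrix (Fin d) (Fin d) ℂ} (hP : P.PosDef)
    (hQ : Q.PosDef) {α : ℝ} (hα : 1 < α) :
    α * P.trace.re + (1 - α) * Q.trace.re ≤ (matrixPow P α * matrixPow Q (1 - α)).trace.re ∧
    ((matrixPow P α * matrixPow Q (1 - α)).trace.re = α * P.trace.re + (1 - α) * Q.trace.re →
      P = Q) := by
  obtain ⟨h1, h2⟩ := trace_young (c := -1) (α := α) hP hQ.1 fun x hx y hy hxy => by
    linarith [lt_rpow_mul_rpow_of_one_lt (hP.spectrum_pos hx).le (hQ.spectrum_pos hy) hxy hα]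
  exact ⟨by linarith, fun h => h2 (by linarith)⟩

/-- Reverse Hölder inequality for traces. -/
theorem trace_rpow_mul_trace_rpow_le {P Q : Matrix (Fin d) (Fin d) ℂ} (hP : P.PosDef)
    (hQ : Q.PosDef) (hP0 : 0 < P.trace.re) (hQ0 : 0 < Q.trace.re) {α : ℝ} (hα : 1 < α) :
    P.trace.re ^ α * Q.trace.re ^ (1 - α) ≤ (matrixPow P α * matrixPow Q (1 - α)).trace.re := by
  -- Young's inequality for the trace-one rescalings has left side `α + (1 - α) = 1`; homogeneity
  -- restores the traces.
  have h := (trace_young_of_one_lt (hP.smul (inv_pos.2 hP0)) (hQ.smul (inv_pos.2 hQ0)) hα).1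
  rw [matrixPow_smul hP.posSemidef (inv_pos.2 hP0).le,
    matrixPow_smul hQ.posSemidef (inv_pos.2 hQ0).le, Real.inv_rpow hP0.le,
    Real.inv_rpow hQ0.le] at h
  have hp := Real.rpow_pos_of_pos hP0 α
  have hq := Real.rpow_pos_of_pos hQ0 (1 - α)
  simp only [Matrix.trace_smul, Complex.smul_re, smul_eq_mul, Matrix.smul_mul, Matrix.mul_smul,
    inv_mul_cancel₀ hP0.ne', inv_mul_cancel₀ hQ0.ne'] at h
  rw [← mul_assoc, ← mul_inv, inv_mul_eq_div, le_div_iff₀ (by positivity)] at h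
  linarith

/-- The scalar Young inequality times `y ^ (q - 1)`, with exponent `q` if `q > 1` and, with `x` and
`y` exchanged, `1 - q` if `q < 0`. -/
theorem rpow_tangent_le {x y q : ℝ} (hx : 0 < x) (hy : 0 < y) (hq : 1 < q ∨ q < 0) :
    y ^ q + q * y ^ (q - 1) * (x - y) ≤ x ^ q := by
  rcases eq_or_ne x y with rfl | hxy
  · simp
  have key : ∀ z : ℝ, 0 < z → z ^ q = z ^ (q - 1) * z := fun z hz => by
    rw [← Real.rpow_add_one hz.ne', sub_add_cancel]
  rcases hq with hq | hq
  · have h := lt_rpow_mul_rpow_of_one_lt hx.le hy hxy hq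
    have h2 := mul_lt_mul_of_pos_right h (Real.rpow_pos_of_pos hy (q - 1))
    rw [mul_assoc, ← Real.rpow_add hy, sub_add_sub_cancel', sub_self, Real.rpow_zero,
      mul_one] at h2
    rw [key y hy]
    linarith
  · have h := lt_rpow_mul_rpow_of_one_lt hy.le hx hxy.symm (α := 1 - q) (by linarith)
    have h2 := mul_lt_mul_of_pos_left h (Real.rpow_pos_of_pos hy (q - 1))
    rw [← mul_assoc, ← Real.rpow_add hy, sub_add_sub_cancel', sub_self, Real.rpow_zero,
      one_mul, sub_sub_cancel] at h2
    rw [key y hy]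
    linarith

theorem trace_matrixPow_tangent_le {X Y : Matrix (Fin d) (Fin d) ℂ} (hX : X.PosDef) (hY : Y.PosDef)
    {q : ℝ} (hq : 1 < q ∨ q < 0) :
    (matrixPow Y q).trace.re + q * (matrixPow Y (q - 1) * (X - Y)).trace.re ≤
      (matrixPow X q).trace.re := by
  have h := klein_inequality hX.1 hY.1 (fun x => x ^ q) (fun x => q * x ^ (q - 1))
    fun x hx y hy => rpow_tangent_le (hX.spectrum_pos hx) (hY.spectrum_pos hy) hq
  rw [cfc_const_mul _ _ Y (continuousOn_real_spectrum _ _), smul_mul_assoc, Matrix.trace_smul,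
    Complex.smul_re, smul_eq_mul] at h
  exact h

/-- The power need not be operator monotone, but its trace is monotone: in the tangent inequality at
`X` the linear term is the trace of a product of positive semidefinite matrices. -/
theorem trace_matrixPow_le_of_one_lt {X Y : Matrix (Fin d) (Fin d) ℂ} (hX : X.PosDef) (hXY : X ≤ Y)
    {q : ℝ} (hq : 1 < q) : (matrixPow X q).trace.re ≤ (matrixPow Y q).trace.re := by
  have h := trace_matrixPow_tangent_le (hX.of_le hXY) hX (Or.inl hq)
  have h' := trace_mul_re_nonneg (matrixPow_posSemidef hX.posSemidef (q - 1)) (Matrix.le_iff.1 hXY)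
  nlinarith

theorem trace_matrixPow_le_of_neg {X Y : Matrix (Fin d) (Fin d) ℂ} (hX : X.PosDef) (hXY : X ≤ Y)
    {q : ℝ} (hq : q < 0) : (matrixPow Y q).trace.re ≤ (matrixPow X q).trace.re := by
  have hY := hX.of_le hXY
  have h := trace_matrixPow_tangent_le hX hY (Or.inr hq)
  have h' := trace_mul_re_nonneg (matrixPow_posSemidef hY.posSemidef (q - 1)) (Matrix.le_iff.1 hXY)
  rw [← neg_sub Y X, mul_neg, Matrix.trace_neg, Complex.neg_re] at h
  nlinarith

/-! ### The Thompson metric -/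

/-- The matrices `V` and `U` are at Thompson distance at most `r`. -/
def LoewnerClose (r : ℝ) (V U : Matrix (Fin d) (Fin d) ℂ) : Prop :=
  Real.exp (-r) • V ≤ U ∧ U ≤ Real.exp r • V

theorem exp_neg_smul_le_iff {r : ℝ} {V U : Matrix (Fin d) (Fin d) ℂ} :
    Real.exp (-r) • V ≤ U ↔ V ≤ Real.exp r • U := by
  constructor <;> intro h
  · have := smul_le_smul_of_nonneg_left h (Real.exp_pos r).le
    rwa [smul_smul, ← Real.exp_add, add_neg_cancel, Real.exp_zero, one_smul] at this
  · have := smul_le_smul_of_nonneg_left h (Real.exp_pos (-r)).le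
    rwa [smul_smul, ← Real.exp_add, neg_add_cancel, Real.exp_zero, one_smul] at this

namespace LoewnerClose

theorem iff_le {r : ℝ} {V U : Matrix (Fin d) (Fin d) ℂ} :
    LoewnerClose r V U ↔ V ≤ Real.exp r • U ∧ U ≤ Real.exp r • V := by
  rw [LoewnerClose, exp_neg_smul_le_iff]

theorem symm {r : ℝ} {V U : Matrix (Fin d) (Fin d) ℂ} (h : LoewnerClose r V U) :
    LoewnerClose r U V := by
  rw [iff_le] at h ⊢
  exact h.symm

theorem trans {r s : ℝ} {U V W : Matrix (Fin d) (Fin d) ℂ} (h : LoewnerClose r U V)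
    (h' : LoewnerClose s V W) : LoewnerClose (r + s) U W := by
  rw [iff_le] at h h' ⊢
  constructor
  · rw [Real.exp_add, ← smul_smul]
    exact h.1.trans (smul_le_smul_of_nonneg_left h'.1 (Real.exp_pos r).le)
  · rw [Real.exp_add, mul_comm, ← smul_smul]
    exact h'.2.trans (smul_le_smul_of_nonneg_left h.2 (Real.exp_pos s).le)

theorem mono {r s : ℝ} {U V : Matrix (Fin d) (Fin d) ℂ} (hU : U.PosSemidef) (hV : V.PosSemidef)
    (hrs : r ≤ s) (h : LoewnerClose r U V) : LoewnerClose s U V := by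
  rw [iff_le] at h ⊢
  exact ⟨h.1.trans (smul_le_smul_of_nonneg_right (Real.exp_le_exp.2 hrs) hV.nonneg),
    h.2.trans (smul_le_smul_of_nonneg_right (Real.exp_le_exp.2 hrs) hU.nonneg)⟩

theorem eq_of_zero {U V : Matrix (Fin d) (Fin d) ℂ} (h : LoewnerClose 0 U V) : U = V := by
  rw [iff_le, Real.exp_zero, one_smul, one_smul] at h
  exact le_antisymm h.1 h.2

theorem refl (U : Matrix (Fin d) (Fin d) ℂ) : LoewnerClose 0 U U := by
  rw [iff_le, Real.exp_zero, one_smul]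
  exact ⟨le_rfl, le_rfl⟩

/-- The source of the contraction: powers in `[-1, 1]` preserve or reverse the order, and
homogeneity turns `exp r` into `exp (s * r)`. -/
theorem matrixPow {r s : ℝ} {U V : Matrix (Fin d) (Fin d) ℂ} (hU : U.PosDef) (hV : V.PosDef)
    (hs : |s| ≤ 1) (h : LoewnerClose r U V) :
    LoewnerClose (|s| * r) (matrixPow U s) (matrixPow V s) := by
  rw [iff_le] at h
  have key : ∀ X : Matrix (Fin d) (Fin d) ℂ, X.PosDef → _root_.matrixPow (Real.exp r • X) s =
      Real.exp (s * r) • _root_.matrixPow X s := fun X hX => by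
    rw [matrixPow_smul hX.posSemidef (Real.exp_pos r).le, ← Real.exp_mul, mul_comm]
  rcases le_total 0 s with hs0 | hs0
  · rw [abs_of_nonneg hs0] at hs ⊢
    rw [iff_le, ← key V hV, ← key U hU]
    exact ⟨matrixPow_le_matrixPow hU.posSemidef h.1 ⟨hs0, hs⟩,
      matrixPow_le_matrixPow hV.posSemidef h.2 ⟨hs0, hs⟩⟩
  · rw [abs_of_nonpos hs0] at hs ⊢
    have hs' : s ∈ Set.Icc (-1 : ℝ) 0 := ⟨by linarith, hs0⟩
    have h1 := matrixPow_le_matrixPow_of_nonpos hU h.1 hs'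
    have h2 := matrixPow_le_matrixPow_of_nonpos hV h.2 hs'
    rw [key V hV] at h1
    rw [key U hU] at h2
    rw [neg_mul, LoewnerClose.iff_le, ← exp_neg_smul_le_iff, ← exp_neg_smul_le_iff, neg_neg]
    exact ⟨h2, h1⟩

theorem smul_right {r c : ℝ} {U V : Matrix (Fin d) (Fin d) ℂ} (hV : V.PosSemidef)
    (hc : 0 < c) (h : LoewnerClose r U V) : LoewnerClose (r + |Real.log c|) U (c • V) := by
  refine h.trans (iff_le.2 ⟨?_, ?_⟩)
  · rw [smul_smul]
    refine (one_smul ℝ V).ge.trans (smul_le_smul_of_nonneg_right ?_ hV.nonneg)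
    calc 1 = Real.exp (-Real.log c) * c := by rw [Real.exp_neg, Real.exp_log hc]; field_simp
      _ ≤ _ := by gcongr; exact neg_le_abs _
  · refine smul_le_smul_of_nonneg_right ?_ hV.nonneg
    calc c = Real.exp (Real.log c) := (Real.exp_log hc).symm
      _ ≤ _ := by gcongr; exact le_abs_self _

theorem trace_le {r : ℝ} {U V B : Matrix (Fin d) (Fin d) ℂ} (hB : B.PosSemidef)
    (h : LoewnerClose r U V) : (B * U).trace.re ≤ Real.exp r * (B * V).trace.re := by
  have := trace_mul_re_nonneg hB (Matrix.le_iff.1 (iff_le.1 h).1)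
  rw [mul_sub, Matrix.trace_sub, Matrix.mul_smul, Matrix.trace_smul, Complex.sub_re,
    Complex.smul_re, smul_eq_mul] at this
  linarith

theorem abs_log_trace_sub_le {r : ℝ} {U V B : Matrix (Fin d) (Fin d) ℂ} (hB : B.PosSemidef)
    (hU : 0 < (B * U).trace.re) (hV : 0 < (B * V).trace.re) (h : LoewnerClose r U V) :
    |Real.log (B * U).trace.re - Real.log (B * V).trace.re| ≤ r := by
  have key : ∀ {X Y : Matrix (Fin d) (Fin d) ℂ}, 0 < (B * X).trace.re → 0 < (B * Y).trace.re →
      LoewnerClose r X Y → Real.log (B * X).trace.re - Real.log (B * Y).trace.re ≤ r := by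
    intro X Y hX hY hXY
    have := Real.log_le_log hX (hXY.trace_le hB)
    rw [Real.log_mul (Real.exp_pos r).ne' hY.ne', Real.log_exp] at this
    linarith
  rw [abs_le]
  exact ⟨by linarith [key hV hU h.symm], key hU hV h⟩

end LoewnerClose

theorem Matrix.PosDef.exists_le_smul {U V : Matrix (Fin d) (Fin d) ℂ} (hU : U.PosSemidef)
    (hV : V.PosDef) : ∃ r : ℝ, 0 ≤ r ∧ U ≤ Real.exp r • V := by
  have hV' := matrixPow_posDef hV (-1)
  have h1 : matrixPow V (-1) ≤ (‖matrixPow V (-1)‖ + 1) • 1 := by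
    refine (IsSelfAdjoint.le_algebraMap_norm_self hV'.1.isSelfAdjoint).trans ?_
    rw [Algebra.algebraMap_eq_smul_one]
    exact smul_le_smul_of_nonneg_right (by linarith) zero_le_one
  -- `V` dominates `C⁻¹ • 1`; the added `1` keeps `C` positive even if the norm vanishes.
  set C := ‖matrixPow V (-1)‖ + 1
  have hC : 0 < C := by positivity
  have h2 := matrixPow_le_matrixPow_of_nonpos hV' h1 (r := -1) ⟨le_rfl, by norm_num⟩
  have hone : matrixPow (1 : Matrix (Fin d) (Fin d) ℂ) (-1) = 1 := by
    rw [matrixPow, cfc_apply_one]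
    simp
  rw [matrixPow_matrixPow hV, neg_mul_neg, one_mul, matrixPow_one hV.1,
    matrixPow_smul Matrix.PosSemidef.one hC.le, hone, Real.rpow_neg_one] at h2
  have h3 : (1 : Matrix (Fin d) (Fin d) ℂ) ≤ C • V := by
    have := smul_le_smul_of_nonneg_left h2 hC.le
    rwa [smul_smul, mul_inv_cancel₀ hC.ne', one_smul] at this
  have h4 : U ≤ ‖U‖ • 1 := by
    rw [← Algebra.algebraMap_eq_smul_one]
    exact IsSelfAdjoint.le_algebraMap_norm_self hU.1.isSelfAdjoint
  refine ⟨‖U‖ * C, by positivity, h4.trans ?_⟩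
  calc ‖U‖ • 1 ≤ ‖U‖ • C • V := smul_le_smul_of_nonneg_left h3 (norm_nonneg U)
    _ ≤ _ := by
      rw [smul_smul]
      exact smul_le_smul_of_nonneg_right (by linarith [Real.add_one_le_exp (‖U‖ * C)])
        hV.posSemidef.nonneg

theorem LoewnerClose.exists {U V : Matrix (Fin d) (Fin d) ℂ} (hU : U.PosDef) (hV : V.PosDef) :
    ∃ r : ℝ, 0 ≤ r ∧ LoewnerClose r U V := by
  obtain ⟨r, hr, h1⟩ := Matrix.PosDef.exists_le_smul hU.posSemidef hV
  obtain ⟨s, hs, h2⟩ := Matrix.PosDef.exists_le_smul hV.posSemidef hU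
  refine ⟨r + s, by positivity, LoewnerClose.iff_le.2 ⟨?_, ?_⟩⟩
  · exact h1.trans (smul_le_smul_of_nonneg_right (Real.exp_le_exp.2 (by linarith))
      hV.posSemidef.nonneg)
  · exact h2.trans (smul_le_smul_of_nonneg_right (Real.exp_le_exp.2 (by linarith))
      hU.posSemidef.nonneg)

theorem LoewnerClose.isClosed (U V : Matrix (Fin d) (Fin d) ℂ) :
    IsClosed {r : ℝ | LoewnerClose r U V} := by
  have h1 : Continuous fun r : ℝ => Real.exp (-r) • U := by fun_prop
  have h2 : Continuous fun r : ℝ => Real.exp r • U := by fun_prop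
  exact (isClosed_le h1 continuous_const).inter (isClosed_le continuous_const h2)

/-- Between positive definite matrices the Thompson metric is finite and its infimum is attained. -/
theorem exists_thompsonDist_eq {U V : Matrix (Fin d) (Fin d) ℂ} (hU : U.PosDef) (hV : V.PosDef) :
    ∃ r : ℝ, 0 ≤ r ∧ LoewnerClose r V U ∧ thompsonDist V U = r := by
  set S := {r : ℝ | 0 ≤ r ∧ LoewnerClose r V U} with hS
  have hne : S.Nonempty := LoewnerClose.exists hV hU
  have hbdd : BddBelow S := ⟨0, fun r hr => hr.1⟩
  have hcl : IsClosed S := isClosed_Ici.inter (LoewnerClose.isClosed V U)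
  obtain ⟨h0, h1⟩ := hcl.csInf_mem hne hbdd
  refine ⟨sInf S, h0, h1, ?_⟩
  have hl : IsLeast ((fun r : ℝ => (r : EReal)) '' S) (sInf S : ℝ) :=
    ⟨⟨sInf S, ⟨h0, h1⟩, rfl⟩, by
      rintro _ ⟨r, hr, rfl⟩
      exact EReal.coe_le_coe_iff.2 (csInf_le hbdd hr)⟩
  exact hl.isGLB.sInf_eq

theorem thompsonDist_le {U V : Matrix (Fin d) (Fin d) ℂ} {r : ℝ} (hr : 0 ≤ r)
    (h : LoewnerClose r V U) : thompsonDist V U ≤ r :=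
  sInf_le ⟨r, ⟨hr, h⟩, rfl⟩

/-- A strict contraction of the Thompson metric on positive definite matrices has a fixed point. -/
theorem exists_fixedPoint_of_contraction {T : Matrix (Fin d) (Fin d) ℂ → Matrix (Fin d) (Fin d) ℂ}
    (hT : ∀ U, U.PosDef → (T U).PosDef) {c : ℝ} (hc : 0 ≤ c) (hc1 : c < 1)
    (hTc : ∀ U V r, U.PosDef → V.PosDef → LoewnerClose r U V → LoewnerClose (c * r) (T U) (T V)) :
    ∃ U, U.PosDef ∧ T U = U := by
  let u : ℕ → Matrix (Fin d) (Fin d) ℂ := fun k => T^[k] 1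
  have hu : ∀ k, (u k).PosDef := fun k => by
    induction k with
    | zero => exact Matrix.PosDef.one
    | succ k ih => simpa only [u, Function.iterate_succ_apply'] using hT _ ih
  have hsucc : ∀ k, u (k + 1) = T (u k) := fun k => Function.iterate_succ_apply' T k 1
  obtain ⟨r, hr, h0⟩ := LoewnerClose.exists (hu 0) (hu 1)
  have hstep : ∀ k, LoewnerClose (c ^ k * r) (u k) (u (k + 1)) := fun k => by
    induction k with
    | zero => simpa using h0
    | succ k ih =>
      rw [hsucc k, hsucc (k + 1), pow_succ', mul_assoc]
      exact hTc _ _ _ (hu k) (hu (k + 1)) ih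
  -- The tail of the geometric series from index `k`, which bounds the distance from `u k` to all
  -- later iterates.
  let R : ℕ → ℝ := fun k => c ^ k * r / (1 - c)
  have hc1' : 0 < 1 - c := by linarith
  have hR : ∀ k, R k = c ^ k * r + R (k + 1) := fun k => by
    simp only [R, pow_succ]
    field_simp
    ring
  have hR0 : ∀ k, 0 ≤ R k := fun k => by positivity
  have hsum : ∀ m k, LoewnerClose (R k - R (k + m)) (u k) (u (k + m)) := fun m => by
    intro k
    induction m with
    | zero => simpa using LoewnerClose.refl (u k)
    | succ m ih =>
      have h := ih.trans (hstep (k + m))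
      rwa [hR (k + m), sub_add_eq_add_sub, add_comm (c ^ (k + m) * r),
        add_sub_add_right_eq_sub] at h
  have hclose : ∀ k m, k ≤ m → LoewnerClose (R k) (u k) (u m) := fun k m hkm => by
    obtain ⟨m, rfl⟩ := Nat.exists_eq_add_of_le hkm
    exact (hsum m k).mono (hu k).posSemidef (hu _).posSemidef (by linarith [hR0 (k + m)])
  -- Compactness stands in for completeness of the Thompson metric: norm-bounded iterates have a
  -- convergent subsequence, and closeness survives the limit because the Loewner order is closed.
  have hbd : ∀ m, u m ∈ Metric.closedBall (0 : Matrix (Fin d) (Fin d) ℂ)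
      ‖Real.exp (R 0) • u 0‖ := fun m => by
    rw [mem_closedBall_zero_iff]
    exact CStarAlgebra.norm_le_norm_of_nonneg_of_le (hu m).posSemidef.nonneg
      (hclose 0 m m.zero_le).2
  obtain ⟨U, -, φ, hφ, hlim⟩ := tendsto_subseq_of_bounded Metric.isBounded_closedBall hbd
  have hcloseU : ∀ k, LoewnerClose (R k) (u k) U := fun k => by
    have hev : ∀ᶠ m in Filter.atTop, LoewnerClose (R k) (u k) (u (φ m)) :=
      (Filter.eventually_ge_atTop k).mono fun m hm => hclose k _ (hm.trans (hφ.id_le m))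
    exact ⟨ge_of_tendsto hlim (hev.mono fun m hm => hm.1),
      le_of_tendsto hlim (hev.mono fun m hm => hm.2)⟩
  have hU : U.PosDef := ((hu 0).smul (Real.exp_pos _)).of_le (hcloseU 0).1
  refine ⟨U, hU, ?_⟩
  have hfix : ∀ k, LoewnerClose (c * R k + R (k + 1)) (T U) U := fun k =>
    (hTc _ _ _ (hu k) hU (hcloseU k)).symm.trans (hsucc k ▸ hcloseU (k + 1))
  have hRlim : Filter.Tendsto R Filter.atTop (nhds 0) := by
    simpa using ((tendsto_pow_atTop_nhds_zero_of_lt_one hc hc1).mul_const r).div_const (1 - c)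
  have hlim0 : Filter.Tendsto (fun k => c * R k + R (k + 1)) Filter.atTop (nhds 0) := by
    simpa using (hRlim.const_mul c).add (hRlim.comp (Filter.tendsto_add_atTop_nat 1))
  exact ((LoewnerClose.isClosed (T U) U).mem_of_tendsto hlim0
    (Filter.Eventually.of_forall hfix)).eq_of_zero

/-! ### The fixed-point iteration -/

/-- Positive weights of sum one and nonzero positive semidefinite matrices that together have full
support. -/
structure IsPositiveSystem (w : Fin n → ℝ) (B : Fin n → Matrix (Fin d) (Fin d) ℂ) : Prop where
  weight_pos : ∀ j, 0 < w j
  weight_sum : ∑ j, w j = 1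
  posSemidef : ∀ j, (B j).PosSemidef
  ne_zero : ∀ j, B j ≠ 0
  posDef_sum : (∑ j, B j).PosDef

/-- The matrix `∑ j, w j / Tr[B j * U] • B j`. -/
noncomputable def weightedSum (w : Fin n → ℝ) (B : Fin n → Matrix (Fin d) (Fin d) ℂ)
    (U : Matrix (Fin d) (Fin d) ℂ) : Matrix (Fin d) (Fin d) ℂ :=
  ∑ j, (w j / (B j * U).trace.re) • B j

/-- One step of the iteration. -/
noncomputable def augustinStep (α : ℝ) (w : Fin n → ℝ) (B : Fin n → Matrix (Fin d) (Fin d) ℂ)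
    (Q : Matrix (Fin d) (Fin d) ℂ) : Matrix (Fin d) (Fin d) ℂ :=
  matrixPow (weightedSum w B (matrixPow Q (1 - α))) (1 / α)

/-- The real-valued objective function. -/
noncomputable def logObjective (α : ℝ) (w : Fin n → ℝ) (B : Fin n → Matrix (Fin d) (Fin d) ℂ)
    (Q : Matrix (Fin d) (Fin d) ℂ) : ℝ :=
  1 / (α - 1) * ∑ j, w j * Real.log (B j * matrixPow Q (1 - α)).trace.re

/-- The restriction `α > 1/2` enters here, as `1 / α < 2`. -/
theorem abs_one_sub_one_div_lt_one {α : ℝ} (hα : α ∈ Set.Ioo (1 / 2 : ℝ) 1 ∪ Set.Ioi 1) :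
    |1 - 1 / α| < 1 := by
  have h : 1 / 2 < α := by
    rcases hα with hα | hα
    · exact hα.1
    · linarith [Set.mem_Ioi.1 hα]
  have h0 : 0 < α := by linarith
  have h1 : 1 / α < 2 := by rw [div_lt_iff₀ h0]; linarith
  have h2 : 0 < 1 / α := by positivity
  rw [abs_lt]
  constructor <;> linarith

theorem Matrix.PosDef.re_trace_pos [NeZero d] {Q : Matrix (Fin d) (Fin d) ℂ} (hQ : Q.PosDef) :
    0 < Q.trace.re :=
  (Complex.pos_iff.1 hQ.trace_pos).1

theorem posDef_sum_smul {B : Fin n → Matrix (Fin d) (Fin d) ℂ} (hB : ∀ j, (B j).PosSemidef)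
    (hsum : (∑ j, B j).PosDef) {c : Fin n → ℝ} (hc : ∀ j, 0 < c j) : (∑ j, c j • B j).PosDef := by
  obtain ⟨m, hm, hmc⟩ : ∃ m : ℝ, 0 < m ∧ ∀ j, m ≤ c j := by
    rcases isEmpty_or_nonempty (Fin n) with h | h
    · exact ⟨1, one_pos, fun j => (h.false j).elim⟩
    · obtain ⟨i, hi⟩ := Finite.exists_min c
      exact ⟨c i, hc i, hi⟩
  refine (hsum.smul hm).of_le ?_
  rw [Finset.smul_sum]
  exact Finset.sum_le_sum fun j _ => smul_le_smul_of_nonneg_right (hmc j) (hB j).nonneg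

/-- Jensen's inequality, from `log u ≤ u - 1` with `u` the ratio of `x j` to the weighted mean. -/
theorem sum_mul_log_le_log_sum {w x : Fin n → ℝ} (hw : ∀ j, 0 < w j) (hw1 : ∑ j, w j = 1)
    (hx : ∀ j, 0 < x j) : ∑ j, w j * Real.log (x j) ≤ Real.log (∑ j, w j * x j) := by
  have hne : (Finset.univ : Finset (Fin n)).Nonempty := by
    by_contra h
    rw [Finset.not_nonempty_iff_eq_empty] at h
    simp [h] at hw1
  have hs : 0 < ∑ j, w j * x j := Finset.sum_pos (fun j _ => mul_pos (hw j) (hx j)) hne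
  have h : ∑ j, w j * Real.log (x j) ≤
      ∑ j, (w j * Real.log (∑ j, w j * x j) + (w j * x j / (∑ j, w j * x j) - w j)) :=
    Finset.sum_le_sum fun j _ => by
      have := Real.log_le_sub_one_of_pos (div_pos (hx j) hs)
      rw [Real.log_div (hx j).ne' hs.ne'] at this
      have := mul_le_mul_of_nonneg_left this (hw j).le
      rw [mul_div_assoc]
      linarith
  rwa [Finset.sum_add_distrib, Finset.sum_sub_distrib, ← Finset.sum_mul, ← Finset.sum_div, hw1,
    div_self hs.ne', sub_self, add_zero, one_mul] at h

/-- Recognizes the mean of trace ratios produced by Jensen as one trace, to which the fixed-point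
equation applies. -/
theorem weightedSum_mul_trace (w : Fin n → ℝ) (B : Fin n → Matrix (Fin d) (Fin d) ℂ)
    (U V : Matrix (Fin d) (Fin d) ℂ) :
    (weightedSum w B U * V).trace.re = ∑ j, w j * ((B j * V).trace.re / (B j * U).trace.re) := by
  rw [weightedSum, Finset.sum_mul, Matrix.trace_sum, Complex.re_sum]
  refine Finset.sum_congr rfl fun j _ => ?_
  rw [smul_mul_assoc, Matrix.trace_smul, Complex.smul_re, smul_eq_mul]
  ring

theorem logObjective_sub {α : ℝ} {w : Fin n → ℝ} {B : Fin n → Matrix (Fin d) (Fin d) ℂ}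
    {P Q : Matrix (Fin d) (Fin d) ℂ} (hP : ∀ j, 0 < (B j * matrixPow P (1 - α)).trace.re)
    (hQ : ∀ j, 0 < (B j * matrixPow Q (1 - α)).trace.re) :
    logObjective α w B P - logObjective α w B Q = 1 / (α - 1) * ∑ j, w j * Real.log
      ((B j * matrixPow P (1 - α)).trace.re / (B j * matrixPow Q (1 - α)).trace.re) := by
  rw [logObjective, logObjective, ← mul_sub, ← Finset.sum_sub_distrib]
  congr 1
  exact Finset.sum_congr rfl fun j _ => by rw [Real.log_div (hP j).ne' (hQ j).ne', mul_sub]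

namespace IsPositiveSystem

variable {w : Fin n → ℝ} {B : Fin n → Matrix (Fin d) (Fin d) ℂ} (hS : IsPositiveSystem w B)
  {α : ℝ} {P Q U V : Matrix (Fin d) (Fin d) ℂ}

include hS

theorem trace_pos (hU : U.PosDef) (j : Fin n) : 0 < (B j * U).trace.re :=
  trace_mul_re_pos (hS.posSemidef j) (hS.ne_zero j) hU

theorem weightedSum_posDef (hU : U.PosDef) : (weightedSum w B U).PosDef :=
  posDef_sum_smul hS.posSemidef hS.posDef_sum fun j =>
    div_pos (hS.weight_pos j) (hS.trace_pos hU j)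

theorem weightedSum_loewnerClose {r : ℝ} (hU : U.PosDef) (hV : V.PosDef)
    (h : LoewnerClose r U V) : LoewnerClose r (weightedSum w B U) (weightedSum w B V) := by
  have key : ∀ {X Y : Matrix (Fin d) (Fin d) ℂ}, X.PosDef → Y.PosDef → LoewnerClose r X Y →
      weightedSum w B Y ≤ Real.exp r • weightedSum w B X := by
    intro X Y hX hY hXY
    rw [weightedSum, weightedSum, Finset.smul_sum]
    refine Finset.sum_le_sum fun j _ => ?_
    rw [smul_smul]
    refine smul_le_smul_of_nonneg_right ?_ (hS.posSemidef j).nonneg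
    have hx := hS.trace_pos hX j
    have hy := hS.trace_pos hY j
    rw [mul_div_assoc', div_le_div_iff₀ hy hx]
    have := mul_le_mul_of_nonneg_left (hXY.trace_le (hS.posSemidef j)) (hS.weight_pos j).le
    linarith
  exact LoewnerClose.iff_le.2 ⟨key hV hU h.symm, key hU hV h⟩

theorem weightedSum_mul_trace_self (hU : U.PosDef) : (weightedSum w B U * U).trace.re = 1 := by
  rw [weightedSum_mul_trace, ← hS.weight_sum]
  exact Finset.sum_congr rfl fun j _ => by rw [div_self (hS.trace_pos hU j).ne', mul_one]

theorem augustinStep_posDef (hQ : Q.PosDef) : (augustinStep α w B Q).PosDef :=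
  matrixPow_posDef (hS.weightedSum_posDef (matrixPow_posDef hQ _)) _

theorem augustinStep_rpow (hα : α ≠ 0) (hQ : Q.PosDef) :
    matrixPow (augustinStep α w B Q) α = weightedSum w B (matrixPow Q (1 - α)) := by
  have h := hS.weightedSum_posDef (matrixPow_posDef hQ (1 - α))
  rw [augustinStep, matrixPow_matrixPow h, one_div_mul_cancel hα, matrixPow_one h.1]

theorem augustinStep_rpow_one_sub (hQ : Q.PosDef) :
    matrixPow (augustinStep α w B Q) (1 - α) =
      matrixPow (weightedSum w B (matrixPow Q (1 - α))) ((1 - α) / α) := by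
  rw [augustinStep, matrixPow_matrixPow (hS.weightedSum_posDef (matrixPow_posDef hQ _)),
    one_div_mul_eq_div]

theorem matrixPow_weightedSum_loewnerClose (hα : |1 - 1 / α| < 1) (hα0 : α ≠ 0) {r : ℝ}
    (hU : U.PosDef) (hV : V.PosDef) (h : LoewnerClose r U V) :
    LoewnerClose (|1 - 1 / α| * r) (matrixPow (weightedSum w B U) ((1 - α) / α))
      (matrixPow (weightedSum w B V) ((1 - α) / α)) := by
  have e : |(1 - α) / α| = |1 - 1 / α| := by
    rw [sub_div, div_self hα0, abs_sub_comm]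
  rw [← e] at hα ⊢
  exact (hS.weightedSum_loewnerClose hU hV h).matrixPow (hS.weightedSum_posDef hU)
    (hS.weightedSum_posDef hV) hα.le

theorem augustinStep_loewnerClose (hα : |1 - 1 / α| < 1) (hα0 : α ≠ 0) {r : ℝ} (hP : P.PosDef)
    (hQ : Q.PosDef) (h : LoewnerClose r (matrixPow P (1 - α)) (matrixPow Q (1 - α))) :
    LoewnerClose (|1 - 1 / α| * r) (matrixPow (augustinStep α w B P) (1 - α))
      (matrixPow (augustinStep α w B Q) (1 - α)) := by
  rw [hS.augustinStep_rpow_one_sub hP, hS.augustinStep_rpow_one_sub hQ]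
  exact hS.matrixPow_weightedSum_loewnerClose hα hα0 (matrixPow_posDef hP _)
    (matrixPow_posDef hQ _) h

theorem exists_fixedPoint (hα : |1 - 1 / α| < 1) (hα0 : α ≠ 0) (hα1 : α ≠ 1) :
    ∃ Q, Q.PosDef ∧ augustinStep α w B Q = Q := by
  have hα1' : 1 - α ≠ 0 := sub_ne_zero.2 hα1.symm
  obtain ⟨U, hU, hfix⟩ := exists_fixedPoint_of_contraction
    (T := fun U => matrixPow (weightedSum w B U) ((1 - α) / α))
    (fun U hU => matrixPow_posDef (hS.weightedSum_posDef hU) _) (abs_nonneg _) hα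
    (fun U V r hU hV h => hS.matrixPow_weightedSum_loewnerClose hα hα0 hU hV h)
  refine ⟨matrixPow U (1 / (1 - α)), matrixPow_posDef hU _, ?_⟩
  rw [augustinStep, matrixPow_matrixPow hU, one_div_mul_cancel hα1', matrixPow_one hU.1]
  conv_rhs => rw [← hfix]
  rw [matrixPow_matrixPow (hS.weightedSum_posDef hU)]
  congr 1
  field_simp

/-- A finite distance `r` between fixed points is at most `|1 - 1/α| ^ k * r` for every `k`. -/
theorem fixedPoint_unique (hα : |1 - 1 / α| < 1) (hα0 : α ≠ 0) (hα1 : α ≠ 1) (hP : P.PosDef)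
    (hQ : Q.PosDef) (hPfix : augustinStep α w B P = P) (hQfix : augustinStep α w B Q = Q) :
    P = Q := by
  have hα1' : 1 - α ≠ 0 := sub_ne_zero.2 hα1.symm
  obtain ⟨r, hr, h⟩ := LoewnerClose.exists (matrixPow_posDef hP (1 - α))
    (matrixPow_posDef hQ (1 - α))
  have hk : ∀ k : ℕ, LoewnerClose (|1 - 1 / α| ^ k * r) (matrixPow P (1 - α))
      (matrixPow Q (1 - α)) := fun k => by
    induction k with
    | zero => simpa using h
    | succ k ih =>
      have := hS.augustinStep_loewnerClose hα hα0 hP hQ ih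
      rwa [hPfix, hQfix, ← mul_assoc, ← pow_succ'] at this
  have hlim : Filter.Tendsto (fun k : ℕ => |1 - 1 / α| ^ k * r) Filter.atTop (nhds 0) := by
    simpa using (tendsto_pow_atTop_nhds_zero_of_lt_one (abs_nonneg _) hα).mul_const r
  have h0 := ((LoewnerClose.isClosed _ _).mem_of_tendsto hlim
    (Filter.Eventually.of_forall hk)).eq_of_zero
  have h1 := congrArg (fun X => matrixPow X (1 / (1 - α))) h0
  simp only [matrixPow_matrixPow hP, matrixPow_matrixPow hQ] at h1
  rwa [mul_one_div_cancel hα1', matrixPow_one hP.1, matrixPow_one hQ.1] at h1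

theorem fixedPoint_rpow (hα : α ≠ 0) (hQ : Q.PosDef) (hfix : augustinStep α w B Q = Q) :
    matrixPow Q α = weightedSum w B (matrixPow Q (1 - α)) := by
  have h := hS.augustinStep_rpow hα hQ
  rwa [hfix] at h

theorem trace_fixedPoint (hα : α ≠ 0) (hQ : Q.PosDef) (hfix : augustinStep α w B Q = Q) :
    Q.trace.re = 1 := by
  have h := hS.weightedSum_mul_trace_self (matrixPow_posDef hQ (1 - α))
  rwa [← hS.fixedPoint_rpow hα hQ hfix, matrixPow_mul_matrixPow hQ, add_sub_cancel,
    matrixPow_one hQ.1] at h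

/-- In particular, normalizing the trace adds `log Tr Q` to the objective. -/
theorem logObjective_smul (hα1 : α ≠ 1) (hQ : Q.PosDef) {c : ℝ} (hc : 0 < c) :
    logObjective α w B (c • Q) = logObjective α w B Q - Real.log c := by
  have hα1' : α - 1 ≠ 0 := sub_ne_zero.2 hα1
  have h : ∀ j, w j * Real.log (B j * matrixPow (c • Q) (1 - α)).trace.re =
      w j * ((1 - α) * Real.log c) + w j * Real.log (B j * matrixPow Q (1 - α)).trace.re :=
    fun j => by
      rw [matrixPow_smul hQ.posSemidef hc.le, Matrix.mul_smul, Matrix.trace_smul, Complex.smul_re,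
        smul_eq_mul, Real.log_mul (Real.rpow_pos_of_pos hc _).ne'
          (hS.trace_pos (matrixPow_posDef hQ _) j).ne', Real.log_rpow hc, mul_add]
  rw [logObjective, logObjective, Finset.sum_congr rfl fun j _ => h j, Finset.sum_add_distrib,
    ← Finset.sum_mul, hS.weight_sum]
  field_simp
  ring

theorem abs_logObjective_sub_le {r : ℝ} (hP : P.PosDef) (hQ : Q.PosDef)
    (h : LoewnerClose r (matrixPow P (1 - α)) (matrixPow Q (1 - α))) :
    |logObjective α w B P - logObjective α w B Q| ≤ |1 / (α - 1)| * r := by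
  have hp := hS.trace_pos (matrixPow_posDef hP (1 - α))
  have hq := hS.trace_pos (matrixPow_posDef hQ (1 - α))
  rw [logObjective_sub hp hq, abs_mul]
  refine mul_le_mul_of_nonneg_left ?_ (abs_nonneg _)
  calc _ ≤ ∑ j, w j * r := (Finset.abs_sum_le_sum_abs _ _).trans <|
        Finset.sum_le_sum fun j _ => by
          rw [abs_mul, abs_of_pos (hS.weight_pos j), Real.log_div (hp j).ne' (hq j).ne']
          exact mul_le_mul_of_nonneg_left
            (h.abs_log_trace_sub_le (hS.posSemidef j) (hp j) (hq j)) (hS.weight_pos j).le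
    _ = r := by rw [← Finset.sum_mul, hS.weight_sum, one_mul]

end IsPositiveSystem

/-- The exponent `1 / (1 - α)` recovers `P` and `Q`. It exceeds `1` for `α < 1` and is negative for
`α > 1`, so the trace of that power is monotone or antitone, and the Loewner bounds pass to the
traces. -/
theorem abs_log_trace_le {α r : ℝ} (hα : α ∈ Set.Ioo (1 / 2 : ℝ) 1 ∪ Set.Ioi 1)
    {P Q : Matrix (Fin d) (Fin d) ℂ} (hP : P.PosDef) (hQ : Q.PosDef) (hP1 : P.trace.re = 1)
    (hQ0 : 0 < Q.trace.re) (h : LoewnerClose r (matrixPow P (1 - α)) (matrixPow Q (1 - α))) :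
    |(1 - α) * Real.log Q.trace.re| ≤ r := by
  have hα1 : 1 - α ≠ 0 := by
    rcases hα with hα | hα
    · linarith [hα.2]
    · have : 1 < α := hα
      linarith
  have hinv : ∀ X : Matrix (Fin d) (Fin d) ℂ, X.PosDef →
      matrixPow (matrixPow X (1 - α)) (1 / (1 - α)) = X := fun X hX => by
    rw [matrixPow_matrixPow hX, mul_one_div_cancel hα1, matrixPow_one hX.1]
  have hsc : ∀ X : Matrix (Fin d) (Fin d) ℂ, X.PosDef →
      (matrixPow (Real.exp r • matrixPow X (1 - α)) (1 / (1 - α))).trace.re =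
        Real.exp (r / (1 - α)) * X.trace.re := fun X hX => by
    rw [matrixPow_smul (matrixPow_posSemidef hX.posSemidef _) (Real.exp_pos r).le, hinv X hX,
      ← Real.exp_mul, mul_one_div, Matrix.trace_smul, Complex.smul_re, smul_eq_mul]
  have key : ∀ {X Y : Matrix (Fin d) (Fin d) ℂ}, X.PosDef → Y.PosDef → 0 < X.trace.re →
      0 < Y.trace.re → LoewnerClose r (matrixPow X (1 - α)) (matrixPow Y (1 - α)) →
      (1 - α) * (Real.log X.trace.re - Real.log Y.trace.re) ≤ r := by
    intro X Y hX hY hX0 hY0 hXY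
    have hle := (LoewnerClose.iff_le.1 hXY).1
    rcases hα with hα | hα
    · have h1 : 0 < 1 - α := by linarith [hα.2]
      have := trace_matrixPow_le_of_one_lt (matrixPow_posDef hX _) hle (q := 1 / (1 - α))
        (by rw [lt_div_iff₀ h1]; linarith [hα.1])
      rw [hinv X hX, hsc Y hY] at this
      have := Real.log_le_log hX0 this
      rw [Real.log_mul (Real.exp_pos _).ne' hY0.ne', Real.log_exp, ← sub_le_iff_le_add,
        le_div_iff₀ h1] at this
      linarith
    · have h1 : 1 - α < 0 := by linarith [Set.mem_Ioi.1 hα]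
      have := trace_matrixPow_le_of_neg (matrixPow_posDef hX _) hle (q := 1 / (1 - α))
        (one_div_neg.2 h1)
      rw [hinv X hX, hsc Y hY] at this
      have := Real.log_le_log (by positivity) this
      rw [Real.log_mul (Real.exp_pos _).ne' hY0.ne', Real.log_exp, ← le_sub_iff_add_le,
        div_le_iff_of_neg h1] at this
      linarith
  have hP0 : 0 < P.trace.re := by rw [hP1]; exact one_pos
  have h1 := key hP hQ hP0 hQ0 h
  have h2 := key hQ hP hQ0 hP0 h.symm
  rw [hP1, Real.log_one] at h1 h2
  rw [abs_le]
  constructor <;> linarith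

/-- Trace normalization at most doubles the distance to a matrix of unit trace. -/
theorem LoewnerClose.trace_normalize {α r : ℝ} (hα : α ∈ Set.Ioo (1 / 2 : ℝ) 1 ∪ Set.Ioi 1)
    {P Q : Matrix (Fin d) (Fin d) ℂ} (hP : P.PosDef) (hQ : Q.PosDef) (hP1 : P.trace.re = 1)
    (hQ0 : 0 < Q.trace.re)
    (h : LoewnerClose r (_root_.matrixPow P (1 - α)) (_root_.matrixPow Q (1 - α))) :
    LoewnerClose (2 * r) (_root_.matrixPow P (1 - α))
      (_root_.matrixPow ((Q.trace.re)⁻¹ • Q) (1 - α)) := by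
  have hq := inv_pos.2 hQ0
  rw [matrixPow_smul hQ.posSemidef hq.le]
  have hc := Real.rpow_pos_of_pos hq (1 - α)
  refine (h.smul_right (matrixPow_posSemidef hQ.posSemidef _) hc).mono
    (matrixPow_posSemidef hP.posSemidef _)
    ((matrixPow_posSemidef hQ.posSemidef _).smul hc.le) ?_
  rw [Real.log_rpow hq, Real.log_inv, mul_neg, abs_neg]
  linarith [abs_log_trace_le hα hP hQ hP1 hQ0 h]

/-! ### Convergence of the iterates and optimality of the fixed point -/

namespace IsPositiveSystem

variable {w : Fin n → ℝ} {B : Fin n → Matrix (Fin d) (Fin d) ℂ} (hS : IsPositiveSystem w B)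
  {α : ℝ} {P Q U V : Matrix (Fin d) (Fin d) ℂ}

include hS

theorem iterate_loewnerClose (hα : |1 - 1 / α| < 1) (hα0 : α ≠ 0) {r : ℝ} (hP : P.PosDef)
    (hfix : augustinStep α w B P = P) {q : ℕ → Matrix (Fin d) (Fin d) ℂ} (hq : ∀ t, (q t).PosDef)
    (hstep : ∀ t, q (t + 1) = augustinStep α w B (q t))
    (h : LoewnerClose r (matrixPow P (1 - α)) (matrixPow (q 0) (1 - α))) (t : ℕ) :
    LoewnerClose (|1 - 1 / α| ^ t * r) (matrixPow P (1 - α)) (matrixPow (q t) (1 - α)) := by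
  induction t with
  | zero => simpa using h
  | succ t ih =>
    have := hS.augustinStep_loewnerClose hα hα0 hP (hq t) ih
    rwa [hfix, ← hstep, ← mul_assoc, ← pow_succ'] at this

/-- For orders below one a fixed point is the unique minimizer. -/
theorem fixedPoint_isMin_of_lt_one (hα0 : 0 < α) (hα1 : α < 1) (hP : P.PosDef)
    (hfix : augustinStep α w B P = P) (hQ : Q.PosSemidef) (hQ1 : Q.trace.re = 1)
    (hQB : ∀ j, 0 < (B j * matrixPow Q (1 - α)).trace.re) :
    logObjective α w B P ≤ logObjective α w B Q ∧
      (logObjective α w B P = logObjective α w B Q → P = Q) := by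
  have hPB := hS.trace_pos (matrixPow_posDef hP (1 - α))
  have hlog := sum_mul_log_le_log_sum hS.weight_pos hS.weight_sum
    fun j => div_pos (hQB j) (hPB j)
  rw [← weightedSum_mul_trace, ← hS.fixedPoint_rpow hα0.ne' hP hfix] at hlog
  obtain ⟨hy, hyeq⟩ := trace_young_of_lt_one hP hQ hα0 hα1
  have htP := hS.trace_fixedPoint hα0.ne' hP hfix
  rw [htP, hQ1, mul_one, mul_one, add_sub_cancel] at hy hyeq
  have hsub := logObjective_sub (w := w) hQB hPB
  have hneg : 1 / (α - 1) < 0 := one_div_neg.2 (by linarith)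
  -- `Q` may be singular, so positivity comes from the ratios in the weighted sum, which is nonempty
  -- as the weights sum to one.
  have hpos : 0 < (matrixPow P α * matrixPow Q (1 - α)).trace.re := by
    refine (trace_mul_re_nonneg (matrixPow_posSemidef hP.posSemidef _)
      (matrixPow_posSemidef hQ _)).lt_of_ne fun h0 => ?_
    rw [hS.fixedPoint_rpow hα0.ne' hP hfix, weightedSum_mul_trace] at h0
    have hz := (Finset.sum_eq_zero_iff_of_nonneg fun j _ =>
      (mul_pos (hS.weight_pos j) (div_pos (hQB j) (hPB j))).le).1 h0.symm
    have hw := hS.weight_sum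
    rw [Finset.sum_eq_zero fun j hj => ?_] at hw
    · exact zero_ne_one hw
    · exact absurd (hz j hj) (mul_pos (hS.weight_pos j) (div_pos (hQB j) (hPB j))).ne'
  have hle := Real.log_le_sub_one_of_pos hpos
  refine ⟨?_, fun heq => hyeq ?_⟩
  · nlinarith
  -- Equality makes the sum of logarithms zero, so the trace is at least `1` and Young's inequality
  -- is tight.
  · rw [heq, sub_self] at hsub
    have := (mul_eq_zero.1 hsub.symm).resolve_left hneg.ne
    linarith

/-- One step decreases the scale-invariant objective function for orders above one. -/
theorem logObjective_augustinStep_le (hα : 1 < α) (hQ : Q.PosDef) (hQ0 : 0 < Q.trace.re)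
    (hQ0' : 0 < (augustinStep α w B Q).trace.re) :
    logObjective α w B (augustinStep α w B Q) - logObjective α w B Q ≤
        1 / (α - 1) * Real.log (augustinStep α w B Q).trace.re ∧
      α * Real.log (augustinStep α w B Q).trace.re ≤ (α - 1) * Real.log Q.trace.re := by
  have hα0 : α ≠ 0 := by linarith
  have hN := hS.augustinStep_posDef (α := α) hQ
  have hrpow := hS.augustinStep_rpow hα0 hQ
  set N := augustinStep α w B Q
  have hNB := hS.trace_pos (matrixPow_posDef hN (1 - α))
  have hQB := hS.trace_pos (matrixPow_posDef hQ (1 - α))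
  constructor
  · have hlog := sum_mul_log_le_log_sum hS.weight_pos hS.weight_sum
      fun j => div_pos (hNB j) (hQB j)
    rw [← weightedSum_mul_trace, ← hrpow, matrixPow_mul_matrixPow hN, add_sub_cancel,
      matrixPow_one hN.1] at hlog
    rw [logObjective_sub hNB hQB]
    exact mul_le_mul_of_nonneg_left hlog (one_div_pos.2 (by linarith)).le
  -- With `N` the new iterate, `Tr[N ^ α Q ^ (1 - α)] = 1`, so reverse Hölder gives `(Tr N) ^ α (Tr
  -- Q) ^ (1 - α) ≤ 1`.
  · have h := trace_rpow_mul_trace_rpow_le hN hQ hQ0' hQ0 hα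
    rw [hrpow, hS.weightedSum_mul_trace_self (matrixPow_posDef hQ _)] at h
    have := Real.log_le_log (by positivity) h
    rw [Real.log_mul (by positivity) (by positivity), Real.log_rpow hQ0', Real.log_rpow hQ0,
      Real.log_one] at this
    linarith

/-- For the new iterate `N`, `F(N) + log Tr N ≤ F(Q) + α / (α - 1) * log Tr N ≤ F(Q) + log Tr Q`. -/
theorem logObjective_normalize_augustinStep_le (hα : 1 < α) (hQ : Q.PosDef)
    (hQ0 : 0 < Q.trace.re) (hQ0' : 0 < (augustinStep α w B Q).trace.re) :
    logObjective α w B (((augustinStep α w B Q).trace.re)⁻¹ • augustinStep α w B Q) ≤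
      logObjective α w B ((Q.trace.re)⁻¹ • Q) := by
  obtain ⟨h1, h2⟩ := hS.logObjective_augustinStep_le hα hQ hQ0 hQ0'
  rw [hS.logObjective_smul hα.ne' (hS.augustinStep_posDef hQ) (inv_pos.2 hQ0'),
    hS.logObjective_smul hα.ne' hQ (inv_pos.2 hQ0), Real.log_inv, Real.log_inv]
  have hα1 : 0 < α - 1 := by linarith
  have e : 1 / (α - 1) * Real.log (augustinStep α w B Q).trace.re +
      Real.log (augustinStep α w B Q).trace.re =
        α * Real.log (augustinStep α w B Q).trace.re / (α - 1) := by
    field_simp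
    ring
  have := (div_le_iff₀ hα1).2 (h2.trans_eq (mul_comm _ _))
  linarith

/-- For orders above one a fixed point minimizes the objective function. -/
theorem fixedPoint_le_of_one_lt [NeZero d] (hα : 1 < α) (hP : P.PosDef)
    (hfix : augustinStep α w B P = P) (hQ : Q.PosDef) (hQ1 : Q.trace.re = 1) :
    logObjective α w B P ≤ logObjective α w B Q := by
  have hα0 : α ≠ 0 := by linarith
  have hc := abs_one_sub_one_div_lt_one (Or.inr hα)
  -- The iteration is started at the competitor: its normalized values never exceed `F(Q)`, yet tend
  -- to `F(P)`.
  let q : ℕ → Matrix (Fin d) (Fin d) ℂ := fun t => (augustinStep α w B)^[t] Q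
  have hstep : ∀ t, q (t + 1) = augustinStep α w B (q t) := fun t =>
    Function.iterate_succ_apply' _ t Q
  have hq : ∀ t, (q t).PosDef := fun t => by
    induction t with
    | zero => exact hQ
    | succ t ih => exact hstep t ▸ hS.augustinStep_posDef ih
  have hdesc : ∀ t, logObjective α w B (((q t).trace.re)⁻¹ • q t) ≤ logObjective α w B Q :=
    fun t => by
      induction t with
      | zero => simp [q, hQ1]
      | succ t ih =>
        refine le_trans ?_ ih
        have h0 := (hq (t + 1)).re_trace_pos
        rw [hstep] at h0 ⊢
        exact hS.logObjective_normalize_augustinStep_le hα (hq t) (hq t).re_trace_pos h0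
  obtain ⟨r, hr, h⟩ := LoewnerClose.exists (matrixPow_posDef hP (1 - α))
    (matrixPow_posDef hQ (1 - α))
  have hle : ∀ t : ℕ, logObjective α w B P ≤
      logObjective α w B Q + |1 / (α - 1)| * (2 * (|1 - 1 / α| ^ t * r)) := fun t => by
    have h1 := hS.abs_logObjective_sub_le hP ((hq t).smul (inv_pos.2 (hq t).re_trace_pos))
      ((hS.iterate_loewnerClose hc hα0 hP hfix hq hstep h t).trace_normalize (Or.inr hα) hP (hq t)
        (hS.trace_fixedPoint hα0 hP hfix) (hq t).re_trace_pos)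
    linarith [le_of_abs_le h1, hdesc t]
  have hlim : Filter.Tendsto (fun t : ℕ => logObjective α w B Q +
      |1 / (α - 1)| * (2 * (|1 - 1 / α| ^ t * r))) Filter.atTop
        (nhds (logObjective α w B Q)) := by
    simpa using ((((tendsto_pow_atTop_nhds_zero_of_lt_one (abs_nonneg _) hc).mul_const
      r).const_mul 2).const_mul |1 / (α - 1)|).const_add (logObjective α w B Q)
  exact ge_of_tendsto' hlim hle

/-- For orders above one a fixed point is the only minimizer. -/
theorem fixedPoint_eq_of_one_lt [NeZero d] (hα : 1 < α) (hP : P.PosDef)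
    (hfix : augustinStep α w B P = P) (hQ : Q.PosDef) (hQ1 : Q.trace.re = 1)
    (heq : logObjective α w B P = logObjective α w B Q) : P = Q := by
  have hα0 : α ≠ 0 := by linarith
  have hN := hS.augustinStep_posDef (α := α) hQ
  have hN0 := hN.re_trace_pos
  have hrpow := hS.augustinStep_rpow hα0 hQ
  obtain ⟨h1, h2⟩ := hS.logObjective_augustinStep_le hα hQ (hQ1 ▸ one_pos) hN0
  have hmin := hS.fixedPoint_le_of_one_lt hα hP hfix (hN.smul (inv_pos.2 hN0))
    (by rw [Matrix.trace_smul, Complex.smul_re, smul_eq_mul, inv_mul_cancel₀ hN0.ne'])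
  rw [hS.logObjective_smul hα.ne' hN (inv_pos.2 hN0), Real.log_inv, heq] at hmin
  rw [hQ1, Real.log_one, mul_zero] at h2
  have hα1 : 0 < 1 / (α - 1) := one_div_pos.2 (by linarith)
  -- Minimality of `P` against the normalized step gives `log Tr N ≥ 0`, while `h2` gives the
  -- opposite sign.
  have hlog : Real.log (augustinStep α w B Q).trace.re = 0 := by nlinarith
  have htr : (augustinStep α w B Q).trace.re = 1 := Real.eq_one_of_pos_of_log_eq_zero hN0 hlog
  have hQfix : augustinStep α w B Q = Q := by
    refine (trace_young_of_one_lt hN hQ hα).2 ?_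
    rw [hrpow, hS.weightedSum_mul_trace_self (matrixPow_posDef hQ _), htr, hQ1]
    ring
  exact hS.fixedPoint_unique (abs_one_sub_one_div_lt_one (Or.inr hα)) hα0 hα.ne' hP hQ hfix hQfix

end IsPositiveSystem

/-! ### The Petz-Augustin mean -/

theorem re_trace_of_mem_quantumStates {Q : Matrix (Fin d) (Fin d) ℂ} (hQ : Q ∈ quantumStates d) :
    Q.trace.re = 1 := by
  rw [hQ.2, Complex.one_re]

theorem mem_quantumStates_of_posSemidef {Q : Matrix (Fin d) (Fin d) ℂ} (hQ : Q.PosSemidef)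
    (hQ1 : Q.trace.re = 1) : Q ∈ quantumStates d :=
  ⟨hQ, by rw [← hQ.ofReal_re_trace, hQ1, Complex.ofReal_one]⟩

theorem traceNormalize_eq {Q : Matrix (Fin d) (Fin d) ℂ} (hQ : Q.PosSemidef) :
    traceNormalize Q = (Q.trace.re)⁻¹ • Q := by
  rw [traceNormalize, ← hQ.ofReal_re_trace, ← Complex.ofReal_inv, Complex.ofReal_re,
    Complex.coe_smul]

theorem mulVec_eq_zero_of_matrixPow {A : Matrix (Fin d) (Fin d) ℂ} (hA : A.PosSemidef) {r : ℝ}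
    (hr : 0 < r) {v : Fin d → ℂ} (h : (matrixPow A r).mulVec v = 0) : A.mulVec v = 0 := by
  rw [← matrixPow_mul_matrixPow_self hA hr, ← Matrix.mulVec_mulVec, h, Matrix.mulVec_zero]

theorem matrixPow_ne_zero {A : Matrix (Fin d) (Fin d) ℂ} (hA : A.PosSemidef) (hA0 : A ≠ 0) {r : ℝ}
    (hr : 0 < r) : matrixPow A r ≠ 0 := fun h =>
  hA0 (by rw [← matrixPow_mul_matrixPow_self hA hr, h, mul_zero])

theorem Matrix.PosSemidef.posDef_of_mulVec {A : Matrix (Fin d) (Fin d) ℂ} (hA : A.PosSemidef)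
    (h : ∀ v, A.mulVec v = 0 → v = 0) : A.PosDef := by
  refine Matrix.PosDef.of_dotProduct_mulVec_pos hA.1 fun x hx => ?_
  refine (hA.dotProduct_mulVec_nonneg x).lt_of_ne fun h0 => hx (h x ?_)
  exact (hA.dotProduct_mulVec_zero_iff x).1 h0.symm

theorem mulVec_eq_zero_of_sum {B : Fin n → Matrix (Fin d) (Fin d) ℂ} (hB : ∀ j, (B j).PosSemidef)
    {v : Fin d → ℂ} (h : (∑ j, B j).mulVec v = 0) (j : Fin n) : (B j).mulVec v = 0 := by
  rw [← (hB j).dotProduct_mulVec_zero_iff]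
  have h0 : ∑ j, star v ⬝ᵥ (B j).mulVec v = 0 := by
    rw [← dotProduct_sum, ← Matrix.sum_mulVec, h, dotProduct_zero]
  exact (Finset.sum_eq_zero_iff_of_nonneg fun j _ => (hB j).dotProduct_mulVec_nonneg v).1 h0 j
    (Finset.mem_univ j)

theorem eq_zero_of_rank_eq {A : Matrix (Fin d) (Fin d) ℂ} (hA : A.rank = d) {v : Fin d → ℂ}
    (h : A.mulVec v = 0) : v = 0 := by
  have hu : IsUnit A := by
    rw [← Matrix.linearIndependent_rows_iff_isUnit, linearIndependent_iff_card_eq_finrank_span,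
      Set.finrank, ← Matrix.rank_eq_finrank_span_row, hA, Fintype.card_fin]
  exact Matrix.mulVec_injective_of_isUnit hu (h.trans (Matrix.mulVec_zero A).symm)

theorem isPositiveSystem_matrixPow {α : ℝ} (hα : 0 < α) {w : Fin n → ℝ} (hw : ∀ j, 0 < w j)
    (hw_sum : ∑ j, w j = 1) {A : Fin n → Matrix (Fin d) (Fin d) ℂ} (hA : ∀ j, A j ∈ quantumStates d)
    (hA_rank : (∑ j, A j).rank = d) : IsPositiveSystem w fun j => matrixPow (A j) α where
  weight_pos := hw
  weight_sum := hw_sum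
  posSemidef j := matrixPow_posSemidef (hA j).1 α
  ne_zero j := matrixPow_ne_zero (hA j).1 (fun h => by
    have := (hA j).2
    rw [h, Matrix.trace_zero] at this
    exact zero_ne_one this) hα
  posDef_sum := by
    refine (Matrix.posSemidef_sum _ fun j _ =>
      matrixPow_posSemidef (hA j).1 α).posDef_of_mulVec fun v hv => eq_zero_of_rank_eq hA_rank ?_
    rw [Matrix.sum_mulVec]
    exact Finset.sum_eq_zero fun j _ => mulVec_eq_zero_of_matrixPow (hA j).1 hα
      (mulVec_eq_zero_of_sum (fun j => matrixPow_posSemidef (hA j).1 α) hv j)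

theorem EReal.coe_finsetSum {ι : Type*} (s : Finset ι) (f : ι → ℝ) :
    ((∑ i ∈ s, f i : ℝ) : EReal) = ∑ i ∈ s, (f i : EReal) :=
  map_sum (⟨⟨((↑) : ℝ → EReal), EReal.coe_zero⟩, EReal.coe_add⟩ : ℝ →+ EReal) f s

theorem augustinObjective_eq_coe {α : ℝ} {w : Fin n → ℝ} {A : Fin n → Matrix (Fin d) (Fin d) ℂ}
    {Q : Matrix (Fin d) (Fin d) ℂ}
    (hker : 1 < α → ∀ j, ∀ v : Fin d → ℂ, Q.mulVec v = 0 → (A j).mulVec v = 0)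
    (htr : ∀ j, 0 < powTrace α (A j) (matrixPow Q (1 - α))) :
    augustinObjective α w A Q = (logObjective α w (fun j => matrixPow (A j) α) Q : ℝ) := by
  rw [augustinObjective, logObjective, Finset.mul_sum, EReal.coe_finsetSum]
  refine Finset.sum_congr rfl fun j _ => ?_
  rw [petzRenyiDiv, if_pos ⟨fun h => hker h j, htr j⟩, ← EReal.coe_mul]
  refine congrArg Real.toEReal ?_
  rw [powTrace]
  ring

theorem augustinObjective_eq_top {α : ℝ} {w : Fin n → ℝ} (hw : ∀ j, 0 < w j)
    {A : Fin n → Matrix (Fin d) (Fin d) ℂ} {Q : Matrix (Fin d) (Fin d) ℂ} {j : Fin n}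
    (h : ¬ ((1 < α → ∀ v : Fin d → ℂ, Q.mulVec v = 0 → (A j).mulVec v = 0) ∧
      0 < powTrace α (A j) (matrixPow Q (1 - α)))) :
    augustinObjective α w A Q = ⊤ := by
  -- Needed because `⊤ + ⊥ = ⊥` in `EReal`: one infinite term decides the sum only if no term is
  -- `⊥`.
  have hbot : ∀ i, (w i : EReal) * petzRenyiDiv α (A i) Q ≠ ⊥ := fun i => by
    rw [petzRenyiDiv]
    split_ifs
    · rw [← EReal.coe_mul]
      exact EReal.coe_ne_bot _
    · rw [EReal.coe_mul_top_of_pos (hw i)]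
      exact top_ne_bot
  have hj : (w j : EReal) * petzRenyiDiv α (A j) Q = ⊤ := by
    rw [petzRenyiDiv, if_neg h, EReal.coe_mul_top_of_pos (hw j)]
  rw [augustinObjective, ← Finset.add_sum_erase _ _ (Finset.mem_univ j), hj]
  refine EReal.top_add_of_ne_bot ?_
  refine Finset.sum_induction _ (fun x : EReal => x ≠ ⊥)
    (fun a b ha hb => ?_) EReal.zero_ne_bot fun i _ => hbot i
  rw [ne_eq, EReal.add_eq_bot_iff]
  tauto

theorem augustinObjective_of_posDef {α : ℝ} {w : Fin n → ℝ}
    {A : Fin n → Matrix (Fin d) (Fin d) ℂ} {Q : Matrix (Fin d) (Fin d) ℂ}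
    (hS : IsPositiveSystem w fun j => matrixPow (A j) α) (hQ : Q.PosDef) :
    augustinObjective α w A Q = (logObjective α w (fun j => matrixPow (A j) α) Q : ℝ) :=
  augustinObjective_eq_coe
    (fun _ j v hv => by
      rw [Matrix.mulVec_injective_of_isUnit hQ.isUnit (hv.trans (Matrix.mulVec_zero Q).symm),
        Matrix.mulVec_zero])
    fun j => hS.trace_pos (matrixPow_posDef hQ _) j

/-- A fixed point of the iteration is the unique minimizer of the objective function. -/
theorem fixedPoint_le_augustinObjective {α : ℝ} (hα : α ∈ Set.Ioo (1 / 2 : ℝ) 1 ∪ Set.Ioi 1)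
    {w : Fin n → ℝ} {A : Fin n → Matrix (Fin d) (Fin d) ℂ} (hA_rank : (∑ j, A j).rank = d)
    (hS : IsPositiveSystem w fun j => matrixPow (A j) α) {P Q : Matrix (Fin d) (Fin d) ℂ}
    (hP : P.PosDef) (hfix : augustinStep α w (fun j => matrixPow (A j) α) P = P)
    (hQ : Q ∈ quantumStates d) :
    augustinObjective α w A P ≤ augustinObjective α w A Q ∧
      (augustinObjective α w A P = augustinObjective α w A Q → P = Q) := by
  have hd : NeZero d := ⟨by
    rintro rfl
    simpa [Matrix.trace] using hQ.2⟩
  have hQ1 := re_trace_of_mem_quantumStates hQ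
  rw [augustinObjective_of_posDef hS hP]
  by_cases h : ∀ j, (1 < α → ∀ v : Fin d → ℂ, Q.mulVec v = 0 → (A j).mulVec v = 0) ∧
      0 < powTrace α (A j) (matrixPow Q (1 - α))
  · rw [augustinObjective_eq_coe (fun hα j => (h j).1 hα) (fun j => (h j).2), EReal.coe_le_coe_iff,
      EReal.coe_eq_coe_iff]
    rcases hα with hα | hα
    · exact hS.fixedPoint_isMin_of_lt_one (by linarith [hα.1]) hα.2 hP hfix hQ.1 hQ1
        fun j => (h j).2
    -- For `α > 1` the support conditions put `ker Q` inside every `ker (A j)`, and full rank of the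
    -- sum makes it trivial.
    · have hQpd : Q.PosDef := hQ.1.posDef_of_mulVec fun v hv => eq_zero_of_rank_eq hA_rank (by
        rw [Matrix.sum_mulVec]
        exact Finset.sum_eq_zero fun j _ => (h j).1 hα v hv)
      exact ⟨hS.fixedPoint_le_of_one_lt hα hP hfix hQpd hQ1,
        hS.fixedPoint_eq_of_one_lt hα hP hfix hQpd hQ1⟩
  · obtain ⟨j, hj⟩ := not_forall.1 h
    rw [augustinObjective_eq_top hS.weight_pos hj]
    exact ⟨le_top, fun h => absurd h (EReal.coe_ne_top _)⟩

/-- The segment from the maximally mixed state `I` to `Q` can be prolonged slightly beyond `Q`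
(parameter `ε < 0`) within the states. So `Q` is a combination of a state and `I` with positive
weight on `I`. -/
theorem posDef_of_mem_intrinsicInterior {Q : Matrix (Fin d) (Fin d) ℂ}
    (hQ : Q ∈ intrinsicInterior ℝ (quantumStates d)) : Q.PosDef ∧ Q ∈ quantumStates d := by
  have hQs : Q ∈ quantumStates d := intrinsicInterior_subset hQ
  refine ⟨?_, hQs⟩
  have hd : d ≠ 0 := by
    rintro rfl
    have := hQs.2
    simp [Matrix.trace] at this
  have hd' : (0 : ℝ) < d := by positivity
  set I : Matrix (Fin d) (Fin d) ℂ := (d : ℝ)⁻¹ • 1 with hI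
  have hIpd : I.PosDef := Matrix.PosDef.one.smul (inv_pos.2 hd')
  have hIs : I ∈ quantumStates d := mem_quantumStates_of_posSemidef hIpd.posSemidef (by
    simp [hI, Matrix.trace_smul, hd])
  obtain ⟨y, hy, rfl⟩ := mem_intrinsicInterior.1 hQ
  let g : ℝ → affineSpan ℝ (quantumStates d) := fun ε =>
    ⟨AffineMap.lineMap (y : Matrix (Fin d) (Fin d) ℂ) I ε,
      AffineMap.lineMap_mem ε y.2 (subset_affineSpan ℝ _ hIs)⟩
  have hg : Continuous g := Continuous.subtype_mk AffineMap.lineMap_continuous _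
  have hg0 : g 0 = y := Subtype.ext (AffineMap.lineMap_apply_zero _ _)
  have hev : ∀ᶠ ε in nhds (0 : ℝ), (g ε : Matrix (Fin d) (Fin d) ℂ) ∈ quantumStates d := by
    have := hg.continuousAt (x := 0) |>.eventually
      (hg0.symm ▸ mem_interior_iff_mem_nhds.1 hy : _ ∈ nhds (g 0))
    exact this
  obtain ⟨ε, hε, hneg⟩ := ((hev.filter_mono nhdsWithin_le_nhds).and
    (self_mem_nhdsWithin : Set.Iio (0 : ℝ) ∈ nhdsWithin 0 (Set.Iio 0))).exists
  have hneg : ε < 0 := hneg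
  have h1 : 0 < 1 - ε := by linarith
  have hpos : ((-ε) • I + (g ε : Matrix (Fin d) (Fin d) ℂ)).PosDef :=
    (hIpd.smul (neg_pos.2 hneg)).add_posSemidef hε.1
  have e : (-ε) • I + (g ε : Matrix (Fin d) (Fin d) ℂ) = (1 - ε) • (y : Matrix _ _ ℂ) := by
    simp only [g, AffineMap.lineMap_apply_module]
    module
  rw [e] at hpos
  have := hpos.smul (inv_pos.2 h1)
  rwa [smul_smul, inv_mul_cancel₀ h1.ne', one_smul] at this

end Augustin

/-! ### The main theorem -/

theorem theorem1 {d n : ℕ} (α : ℝ) (hα : α ∈ Set.Ioo (1 / 2 : ℝ) 1 ∪ Set.Ioi 1)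
    (w : Fin n → ℝ) (hw : ∀ j, 0 < w j) (hw_sum : ∑ j, w j = 1)
    (A : Fin n → Matrix (Fin d) (Fin d) ℂ) (hA : ∀ j, A j ∈ quantumStates d)
    (hA_rank : (∑ j, A j).rank = d)
    (Q : ℕ → Matrix (Fin d) (Fin d) ℂ)
    (hQ_init : Q 1 ∈ intrinsicInterior ℝ (quantumStates d))
    (hQ_step : ∀ t, 1 ≤ t →
      Q (t + 1) = matrixPow (augustinOperator α w A (matrixPow (Q t) (1 - α))) (1 / (1 - α))) :
    -- the iterates are positive definite and have the explicit form
    (∀ t, 1 ≤ t → (Q t).PosDef ∧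
      Q (t + 1) = matrixPow (∑ j, (w j / powTrace α (A j) (matrixPow (Q t) (1 - α))) •
        matrixPow (A j) α) (1 / α)) ∧
    -- the minimizer exists, is unique, and is positive definite with a finite value
    (∃! Qs, IsPetzAugustinMean α w A Qs) ∧
    (∀ Qs, IsPetzAugustinMean α w A Qs →
      Qs.PosDef ∧ augustinObjective α w A Qs ≠ ⊤ ∧ augustinObjective α w A Qs ≠ ⊥ ∧
      -- convergence
      (∀ T : ℕ,
        augustinObjective α w A (traceNormalize (Q (T + 1))) - augustinObjective α w A Qs ≤
            ((|1 / (α - 1)| : ℝ) : EReal) *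
              thompsonDist (matrixPow Qs (1 - α))
                (matrixPow (traceNormalize (Q (T + 1))) (1 - α)) ∧
        ((|1 / (α - 1)| : ℝ) : EReal) *
              thompsonDist (matrixPow Qs (1 - α))
                (matrixPow (traceNormalize (Q (T + 1))) (1 - α)) ≤
            ((|2 / (α - 1)| * |1 - 1 / α| ^ T : ℝ) : EReal) *
              thompsonDist (matrixPow Qs (1 - α)) (matrixPow (Q 1) (1 - α))) ∧
      thompsonDist (matrixPow Qs (1 - α)) (matrixPow (Q 1) (1 - α)) < ⊤) ∧
    -- monotonicity of the function values
    (1 < α → ∀ t, 1 ≤ t →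
      augustinObjective α w A (traceNormalize (Q (t + 1))) ≤
        augustinObjective α w A (traceNormalize (Q t))) := by
  have hα0 : 0 < α := by
    rcases hα with hα | hα
    · linarith [hα.1]
    · exact one_pos.trans hα
  have hα1 : α ≠ 1 := by
    rcases hα with hα | hα
    · exact hα.2.ne
    · exact (Set.mem_Ioi.1 hα).ne'
  have hα1' : 1 - α ≠ 0 := sub_ne_zero.2 hα1.symm
  have hc := abs_one_sub_one_div_lt_one hα
  have hS := isPositiveSystem_matrixPow hα0 hw hw_sum hA hA_rank
  obtain ⟨hQ1, hQ1s⟩ := posDef_of_mem_intrinsicInterior hQ_init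
  have hd : NeZero d := ⟨by
    rintro rfl
    simpa [Matrix.trace] using hQ1s.2⟩
  have hnext : ∀ t, 1 ≤ t → (Q t).PosDef →
      Q (t + 1) = augustinStep α w (fun j => matrixPow (A j) α) (Q t) := fun t ht hQt => by
    rw [hQ_step t ht]
    change matrixPow (matrixPow (weightedSum w _ _) _) _ = matrixPow (weightedSum w _ _) _
    rw [matrixPow_matrixPow (hS.weightedSum_posDef (matrixPow_posDef hQt _))]
    congr 1
    field_simp
  -- The index is shifted because `Q 0` is arbitrary.
  have hpd : ∀ t, (Q (t + 1)).PosDef := fun t => by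
    induction t with
    | zero => exact hQ1
    | succ t ih => exact hnext (t + 1) t.succ_pos ih ▸ hS.augustinStep_posDef ih
  have hstep : ∀ t, Q (t + 1 + 1) = augustinStep α w (fun j => matrixPow (A j) α) (Q (t + 1)) :=
    fun t => hnext (t + 1) t.succ_pos (hpd t)
  have hobj : ∀ t, augustinObjective α w A (traceNormalize (Q (t + 1))) =
      (logObjective α w (fun j => matrixPow (A j) α)
        (((Q (t + 1)).trace.re)⁻¹ • Q (t + 1)) : ℝ) := fun t => by
    rw [traceNormalize_eq (hpd t).posSemidef, augustinObjective_of_posDef hS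
      ((hpd t).smul (inv_pos.2 (hpd t).re_trace_pos))]
  obtain ⟨P, hP, hfix⟩ := hS.exists_fixedPoint hc hα0.ne' hα1
  have hP1 := hS.trace_fixedPoint hα0.ne' hP hfix
  have hPs := mem_quantumStates_of_posSemidef hP.posSemidef hP1
  have hPmean : IsPetzAugustinMean α w A P := ⟨hPs, fun R hR =>
    (fixedPoint_le_augustinObjective hα hA_rank hS hP hfix hR).1⟩
  have huniq : ∀ R, IsPetzAugustinMean α w A R → R = P := fun R hR =>
    have h := fixedPoint_le_augustinObjective hα hA_rank hS hP hfix hR.1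
    (h.2 (le_antisymm h.1 (hR.2 hPs))).symm
  refine ⟨fun t ht => ?_, ⟨P, hPmean, huniq⟩, fun R hR => ?_, fun hα t ht => ?_⟩
  · obtain ⟨t, rfl⟩ := Nat.exists_eq_add_of_le' ht
    exact ⟨hpd t, hstep t⟩
  · obtain rfl := huniq R hR
    obtain ⟨r, hr, hclose, hdist⟩ := exists_thompsonDist_eq (matrixPow_posDef hQ1 (1 - α))
      (matrixPow_posDef hP (1 - α))
    refine ⟨hP, ?_, ?_, fun T => ?_, ?_⟩
    · rw [augustinObjective_of_posDef hS hP]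
      exact EReal.coe_ne_top _
    · rw [augustinObjective_of_posDef hS hP]
      exact EReal.coe_ne_bot _
    · have hTpd := (hpd T).smul (inv_pos.2 (hpd T).re_trace_pos)
      have hT := (hS.iterate_loewnerClose hc hα0.ne' hP hfix (q := fun t => Q (t + 1)) hpd hstep
        hclose T).trace_normalize hα hP (hpd T) hP1 (hpd T).re_trace_pos
      obtain ⟨s, -, hsclose, hsdist⟩ := exists_thompsonDist_eq (matrixPow_posDef hTpd (1 - α))
        (matrixPow_posDef hP (1 - α))
      -- The factor `2` is the cost of normalizing the trace; `|1 - 1/α| ^ T` comes from the `T`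
      -- steps between `Q 1` and `Q (T + 1)`.
      have hs : s ≤ 2 * (|1 - 1 / α| ^ T * r) :=
        EReal.coe_le_coe_iff.1 (hsdist ▸ thompsonDist_le (by positivity) hT)
      rw [hobj T, augustinObjective_of_posDef hS hP, traceNormalize_eq (hpd T).posSemidef, hsdist,
        hdist, ← EReal.coe_sub, ← EReal.coe_mul, ← EReal.coe_mul, EReal.coe_le_coe_iff,
        EReal.coe_le_coe_iff]
      refine ⟨?_, ?_⟩
      · have h := (abs_le.1 (hS.abs_logObjective_sub_le hP hTpd hsclose)).1
        linarith
      · calc |1 / (α - 1)| * s ≤ |1 / (α - 1)| * (2 * (|1 - 1 / α| ^ T * r)) :=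
              mul_le_mul_of_nonneg_left hs (abs_nonneg _)
          _ = |2 / (α - 1)| * |1 - 1 / α| ^ T * r := by
              rw [abs_div, abs_div 2, abs_one, abs_two]
              ring
    · rw [hdist]
      exact EReal.coe_lt_top r
  · obtain ⟨t, rfl⟩ := Nat.exists_eq_add_of_le' ht
    have h0 := (hpd (t + 1)).re_trace_pos
    rw [hobj, hobj, EReal.coe_le_coe_iff]
    rw [hstep] at h0 ⊢
    exact hS.logObjective_normalize_augustinStep_le hα (hpd t) (hpd t).re_trace_pos h0
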